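/- Let $n\ge 3$, let $(M^n,[g])$ and $(N^n,[h])$ be smooth pseudo-Riemannian conformal manifolds of the same signature $(p,q)$, where $[g]=\{\Omega^2 g:\Omega\in C^\infty(M),\ \Omega>0\}$ and likewise for $[h]$. For $g\in[g]$ let $\nabla$ be its Levi-Civita connection, $P=\frac1{n-2}\left(\mathrm{Ric}-\frac{\mathrm{scal}}{2(n-1)}\,g\right)$ its Schouten tensor, and $S_{jk}{}^{il}=\delta^i_j\delta^l_k+\delta^l_j\delta^i_k-g_{jk}g^{il}$. A (parametrized) conformal circle of $(M,[g])$ is a smooth regular curve $\gamma$ on an open interval such that, for some $g\in[g]$ and some 1-form $b$ along $\gamma$, $$\nabla_{\dot\gamma}\dot\gamma^i=-S_{jk}{}^{il}\,b_l\,\dot\gamma^j\dot\gamma^k,\qquad \nabla_{\dot\gamma}b_i=\left(\tfrac12\, b_jb_l\,S_{ki}{}^{jl}+P_{ki}\right)\dot\gamma^k .$$ (This does not depend on the choice of $g\in[g]$.) An unparametrized conformal circle is a smooth curve on a nonempty open interval which near each point of the interval becomes a conformal circle after a smooth regular change of parameter. The curves may be null or non-null. Let $f\colon M\to N$ be a smooth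 local diffeomorphism such that - if $p\ne q$: for every $v\in TM$, $df(v)$ is null if and only if $v$ is null; - if $p=q$: $\operatorname{sgn}\langle v,v\rangle_g=\operatorname{sgn}\langle df(v),df(v)\rangle_h$ for every $v\in TM$. Then $f$ maps unparametrized conformal circles to unparametrized conformal circles (that is, $f\circ\gamma$ is an unparametrized conformal circle of $(N,[h])$ for every unparametrized conformal circle $\gamma$ of $(M,[g])$) if and only if $f$ is a conformal transformation, that is, $f^*h=\Omega^2 g$ for some smooth function $\Omega>0$ on $M$. -/

import Mathlib

open Set Filter Topology
open scoped Manifold ContDiff Bundle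

namespace ConformalCircles

/-- The model space `ℝⁿ`. -/
abbrev Coord (n : ℕ) : Type := EuclideanSpace ℝ (Fin n)

/-! ### Tensor calculus of a metric in coordinates

Here `G y` is the matrix `g_{ij}(y)` of a metric in a coordinate system, seen as a bilinear form
on `ℝⁿ`; all formulas are evaluated at a point near which `G` is smooth and nondegenerate. -/

section Coordinates

variable {n : ℕ}

/-- A field of bilinear forms on `ℝⁿ`. -/
abbrev FormField (n : ℕ) : Type := Coord n → Coord n →L[ℝ] Coord n →L[ℝ] ℝ

/-- Raising an index: `sharp G y β` is the vector `β♯` with `G y β♯ w = β w` for all `w`. -/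
noncomputable def sharp (G : FormField n) (y : Coord n) (β : Coord n →L[ℝ] ℝ) : Coord n :=
  (G y).inverse β

/-- The Christoffel symbols `Γ^k_{ij} u^i v^j` of the Levi-Civita connection:
`2 g(Γ(u, v), w) = (∂_u g)(v, w) + (∂_v g)(u, w) - (∂_w g)(u, v)`. -/
noncomputable def christoffel (G : FormField n) (y u v : Coord n) : Coord n :=
  sharp G y ((1 / 2 : ℝ) •
    (fderiv ℝ G y u v + fderiv ℝ G y v u - fderiv ℝ (fun z => G z u v) y))

/-- The curvature `R(u, v) w = ∇_u ∇_v w - ∇_v ∇_u w` on constant coordinate fields `u, v, w`. -/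
noncomputable def curvature (G : FormField n) (y u v w : Coord n) : Coord n :=
  fderiv ℝ (fun z => christoffel G z v w) y u - fderiv ℝ (fun z => christoffel G z u w) y v
    + christoffel G y u (christoffel G y v w) - christoffel G y v (christoffel G y u w)

/-- The Ricci tensor: `Ric(v, w)` is the trace of `u ↦ R(u, v) w`. -/
noncomputable def ricci (G : FormField n) (y v w : Coord n) : ℝ :=
  ∑ i : Fin n, (curvature G y (EuclideanSpace.single i 1) v w) i

/-- The scalar curvature `g^{ij} Ric_{ij}`. -/
noncomputable def scalarCurvature (G : FormField n) (y : Coord n) : ℝ :=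
  ∑ i : Fin n, ricci G y (EuclideanSpace.single i 1) (sharp G y (EuclideanSpace.proj i))

/-- The Schouten tensor `P = (Ric - scal / (2 (n - 1)) g) / (n - 2)`. -/
noncomputable def schouten (G : FormField n) (y v w : Coord n) : ℝ :=
  (1 / ((n : ℝ) - 2)) *
    (ricci G y v w - scalarCurvature G y / (2 * ((n : ℝ) - 1)) * G y v w)

/-- The conformal circle system at time `t`, in coordinates, for a curve `x` and a 1-form `β`
along it. With `u = ẋ` and `S_{jk}^{il} = δ^i_j δ^l_k + δ^l_j δ^i_k - g_{jk} g^{il}` it reads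
* `∇_u u^i = -S_{jk}^{il} β_l u^j u^k`, that is `∇_u u = -(2 β(u) u - g(u, u) β♯)`;
* `∇_u β_i = (½ β_j β_l S_{ki}^{jl} + P_{ki}) u^k`, that is
  `(∇_u β)(w) = β(u) β(w) - ½ |β|² g(u, w) + P(u, w)`,
where `∇_u u = u' + Γ(u, u)` and `(∇_u β)(w) = (β w)' - β(Γ(u, w))` for constant `w`. -/
def CircleSystemAt (G : FormField n) (x : ℝ → Coord n) (β : ℝ → Coord n →L[ℝ] ℝ)
    (t : ℝ) : Prop :=
  deriv (deriv x) t + christoffel G (x t) (deriv x t) (deriv x t) =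
      -((2 * β t (deriv x t)) • deriv x t
        - (G (x t) (deriv x t) (deriv x t)) • sharp G (x t) (β t)) ∧
    ∀ w : Coord n, HasDerivAt (fun s => β s w)
      (β t (christoffel G (x t) (deriv x t) w)
        + (β t (deriv x t) * β t w
          - 1 / 2 * β t (sharp G (x t) (β t)) * G (x t) (deriv x t) w
          + schouten G (x t) (deriv x t) w)) t

end Coordinates

/-! ### Pseudo-Riemannian metrics and conformal classes -/

/-- A smooth pseudo-Riemannian metric of signature `(p, q)` on the `n`-manifold `M`. -/
structure PseudoMetric (n p q : ℕ) (M : Type*) [TopologicalSpace M] [ChartedSpace (Coord n) M]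
    [IsManifold (𝓡 n) ∞ M] where
  /-- The bilinear form on each tangent space. -/
  val : ∀ x : M, TangentSpace (𝓡 n) x →L[ℝ] TangentSpace (𝓡 n) x →L[ℝ] ℝ
  symm : ∀ (x : M) (v w : TangentSpace (𝓡 n) x), val x v w = val x w v
  signature : ∀ x : M, ∃ e : Module.Basis (Fin p ⊕ Fin q) ℝ (TangentSpace (𝓡 n) x),
    ∀ v : TangentSpace (𝓡 n) x, val x v v =
      ∑ i : Fin p, (e.repr v (Sum.inl i)) ^ 2 - ∑ j : Fin q, (e.repr v (Sum.inr j)) ^ 2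
  contMDiff : ContMDiff (𝓡 n) ((𝓡 n).prod 𝓘(ℝ, Coord n →L[ℝ] Coord n →L[ℝ] ℝ)) ∞
    (fun x => Bundle.TotalSpace.mk' (Coord n →L[ℝ] Coord n →L[ℝ] ℝ)
      (E := fun x : M => TangentSpace (𝓡 n) x →L[ℝ] TangentSpace (𝓡 n) x →L[ℝ] ℝ) x (val x))

section Manifold

variable {n p q : ℕ} {M : Type*} [TopologicalSpace M] [ChartedSpace (Coord n) M]
  [IsManifold (𝓡 n) ∞ M] {N : Type*} [TopologicalSpace N] [ChartedSpace (Coord n) N]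
  [IsManifold (𝓡 n) ∞ N]

/-- `g' = Ω² g` for a smooth positive function `Ω`. -/
def ConformallyRelated (g g' : PseudoMetric n p q M) : Prop :=
  ∃ Ω : M → ℝ, ContMDiff (𝓡 n) 𝓘(ℝ, ℝ) ∞ Ω ∧ (∀ x, 0 < Ω x) ∧
    ∀ (x : M) (v w : TangentSpace (𝓡 n) x), g'.val x v w = Ω x ^ 2 * g.val x v w

theorem conformallyRelated_equivalence :
    Equivalence (ConformallyRelated : PseudoMetric n p q M → PseudoMetric n p q M → Prop) where
  refl g := ⟨fun _ => 1, contMDiff_const, fun _ => one_pos, fun x v w => by simp⟩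
  symm := by
    rintro g g' ⟨Ω, hΩ, hpos, h⟩
    refine ⟨fun x => (Ω x)⁻¹, hΩ.inv₀ fun x => (hpos x).ne', fun x => inv_pos.2 (hpos x),
      fun x v w => ?_⟩
    have := (hpos x).ne'
    rw [h]
    field_simp
  trans := by
    rintro g g' g'' ⟨Ω, hΩ, hpos, h⟩ ⟨Ω', hΩ', hpos', h'⟩
    refine ⟨fun x => Ω' x * Ω x, hΩ'.mul hΩ, fun x => mul_pos (hpos' x) (hpos x),
      fun x v w => ?_⟩
    rw [h', h]
    ring

/-- Conformal equivalence of metrics. -/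
instance metricSetoid (n p q : ℕ) (M : Type*) [TopologicalSpace M] [ChartedSpace (Coord n) M]
    [IsManifold (𝓡 n) ∞ M] : Setoid (PseudoMetric n p q M) :=
  ⟨ConformallyRelated, conformallyRelated_equivalence⟩

/-- A conformal class `[g]` of metrics of signature `(p, q)` on `M`. -/
def ConformalClass (n p q : ℕ) (M : Type*) [TopologicalSpace M] [ChartedSpace (Coord n) M]
    [IsManifold (𝓡 n) ∞ M] : Type _ :=
  Quotient (metricSetoid n p q M)

/-- `g` is a representative of the conformal class `c`. -/
def PseudoMetric.Represents (g : PseudoMetric n p q M) (c : ConformalClass n p q M) : Prop :=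
  Quotient.mk (metricSetoid n p q M) g = c

/-- The sign of `⟨v, v⟩`, which is the same for all metrics in the conformal class; a vector
is null if this sign is `0`. -/
noncomputable def ConformalClass.sgn (c : ConformalClass n p q M) (x : M)
    (v : TangentSpace (𝓡 n) x) : SignType :=
  Quotient.lift (fun g : PseudoMetric n p q M => SignType.sign (g.val x v v))
    (by
      rintro g g' ⟨Ω, -, hpos, h⟩
      simp [h, sign_mul, sign_pos (pow_pos (hpos x) 2)]) c

/-! ### Conformal circles -/

/-- The coordinate frame at `x` of the chart around `x₀`: the inverse of the differential at `x`
of the chart `extChartAt (𝓡 n) x₀` (used for `x` in the source of that chart). -/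
noncomputable def coordFrame (x₀ x : M) : Coord n →L[ℝ] TangentSpace (𝓡 n) x :=
  (trivializationAt (Coord n) (TangentSpace (𝓡 n)) x₀).symmL ℝ x

/-- The matrix `g_{ij}` of the metric `g` in the chart around `x₀`: at `y` it is the form
`(u, v) ↦ g(L u, L v)`, where `L` is the coordinate frame at the point with coordinates `y`. -/
noncomputable def PseudoMetric.inChart (g : PseudoMetric n p q M) (x₀ : M) : FormField n :=
  fun y =>
    let L := coordFrame (M := M) x₀ ((extChartAt (𝓡 n) x₀).symm y)
    (ContinuousLinearMap.precomp ℝ L).comp ((g.val ((extChartAt (𝓡 n) x₀).symm y)).comp L)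

/-- The curve `γ` (regular and smooth on the open interval `K`) together with the 1-form `b`
along it satisfies the conformal circle system of the metric `g` on `K`: this is the system
`CircleSystemAt` for their expressions in every chart. -/
structure PseudoMetric.IsCircle (g : PseudoMetric n p q M) (γ : ℝ → M)
    (b : ∀ t : ℝ, TangentSpace (𝓡 n) (γ t) →L[ℝ] ℝ) (K : Set ℝ) : Prop where
  smooth : ContMDiffOn 𝓘(ℝ, ℝ) (𝓡 n) ∞ γ K
  regular : ∀ t ∈ K, mfderiv 𝓘(ℝ, ℝ) (𝓡 n) γ t ≠ 0
  system : ∀ x₀ : M, ∀ t ∈ K, γ t ∈ (extChartAt (𝓡 n) x₀).source →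
    CircleSystemAt (g.inChart x₀) (fun s => extChartAt (𝓡 n) x₀ (γ s))
      (fun s => (b s).comp (coordFrame x₀ (γ s))) t

/-- `γ` is a (parametrized) conformal circle of the conformal class `c` on the open interval `K`:
it solves the conformal circle system of a metric in `c`, with some 1-form `b` along it. -/
def ConformalClass.IsConformalCircle (c : ConformalClass n p q M) (γ : ℝ → M) (K : Set ℝ) : Prop :=
  ∃ g : PseudoMetric n p q M, g.Represents c ∧
    ∃ b : ∀ t : ℝ, TangentSpace (𝓡 n) (γ t) →L[ℝ] ℝ, g.IsCircle γ b K

/-- `γ` is an unparametrized conformal circle on the open interval `J`: it is smooth, and near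
each of its points it becomes a conformal circle after a regular change of parameter `φ`. -/
def ConformalClass.IsUnparametrizedCircle (c : ConformalClass n p q M) (γ : ℝ → M)
    (J : Set ℝ) : Prop :=
  ContMDiffOn 𝓘(ℝ, ℝ) (𝓡 n) ∞ γ J ∧
    ∀ t ∈ J, ∃ (K : Set ℝ) (φ : ℝ → ℝ), IsOpen K ∧ K.OrdConnected ∧
      ContDiffOn ℝ ∞ φ K ∧ (∀ s ∈ K, deriv φ s ≠ 0) ∧ MapsTo φ K J ∧ t ∈ φ '' K ∧
      c.IsConformalCircle (γ ∘ φ) K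

/-- `f` maps unparametrized conformal circles to unparametrized conformal circles. -/
def MapsCircles (c : ConformalClass n p q M) (d : ConformalClass n p q N) (f : M → N) : Prop :=
  ∀ (γ : ℝ → M) (J : Set ℝ), IsOpen J → J.OrdConnected → J.Nonempty →
    c.IsUnparametrizedCircle γ J → d.IsUnparametrizedCircle (f ∘ γ) J

/-- `f` is conformal: `f^*h = Ω² g` with `Ω` smooth and positive, for representatives `g`, `h`. -/
def IsConformalTransformation (c : ConformalClass n p q M) (d : ConformalClass n p q N)
    (f : M → N) : Prop :=
  ∀ (g : PseudoMetric n p q M) (h : PseudoMetric n p q N), g.Represents c → h.Represents d →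
    ∃ Ω : M → ℝ, ContMDiff (𝓡 n) 𝓘(ℝ, ℝ) ∞ Ω ∧ (∀ x, 0 < Ω x) ∧
      ∀ (x : M) (v w : TangentSpace (𝓡 n) x),
        h.val (f x) (mfderiv (𝓡 n) (𝓡 n) f x v) (mfderiv (𝓡 n) (𝓡 n) f x w) =
          Ω x ^ 2 * g.val x v w

end Manifold

end ConformalCircles

/-!
The two directions rest on different facts.

*Conformal maps preserve circles.* The conformal circle system is natural under isometries and, for
`G' = e^{2ρ} G`, is carried into itself by the substitution `b ↦ b - dρ`. This follows from the
transformation of the Levi-Civita connection and of the Schouten tensor, which are computed in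
coordinates (`IsIsometryOn.circleSystemL`, `IsConformalOn.circleSystemL`). A local diffeomorphism
with `f^*h = Ω² g` is, in charts, a conformal change followed by a local isometry, which gives
`circleSystemAt_transfer` and `PseudoMetric.IsCircle.map`.

*Maps preserving circles are conformal.* If the metrics are indefinite, the null cone alone
suffices: a symmetric form that vanishes on the null cone of an indefinite form is a multiple of it
(`exists_eq_smul_of_null`). The factor is positive because of the hypothesis on signs if `p = q`,
and by the law of inertia if `p ≠ q` (`pos_of_pullback_eq_smul`).

If the metrics are definite, the circles have to be used. Eliminating `b` and the parameter from the
system leaves the third-order equation, with `u = ẋ` and `a = ∇_u u`,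
`∇_u a ≡ 3 g(u, a) / g(u, u) a + g(u, u) P♯ u` modulo `u`
(`ThirdOrder.of_circle`, `ThirdOrder.of_comp`). There are circles with arbitrary initial velocity
`u` and acceleration `a` (`PseudoMetric.exists_isCircle`), and the images of these satisfy the same
equation for `h`. In the difference of the two equations the third derivatives cancel modulo `u`,
and the terms quadratic in `a` give
`(g(u, a) / g(u, u) - h(Fu, Fa) / h(Fu, Fu)) Fa ∈ ℝ Fu` for `F = df`. Hence the two quotients agree
(`MapsCircles.form_div_eq`), so `f^*h` and `g` have the same orthogonality relation, and two
definite forms with this property are proportional (`exists_eq_smul_of_div_eq`).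

In both cases the factor is a quotient of smooth functions, so that its square root is a smooth
conformal factor (`contMDiff_of_pullback_eq_smul`).
-/

-- Instance search on iterated spaces of continuous linear maps exceeds the default limits.
set_option maxSynthPendingDepth 3
set_option synthInstance.maxHeartbeats 100000

namespace ConformalCircles

/-! ### The Levi-Civita connection of a metric in coordinates -/

section

section Calculus

variable {X E F H : Type*} [NormedAddCommGroup X] [NormedSpace ℝ X]
  [NormedAddCommGroup E] [NormedSpace ℝ E] [NormedAddCommGroup F] [NormedSpace ℝ F]
  [NormedAddCommGroup H] [NormedSpace ℝ H]

theorem fderiv_apply_const {A : X → E →L[ℝ] F} {x : X} (hA : DifferentiableAt ℝ A x) (v : E)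
    (u : X) : fderiv ℝ (fun z => A z v) x u = fderiv ℝ A x u v := by
  rw [(hA.hasFDerivAt.clm_apply (hasFDerivAt_const v x)).fderiv]
  simp

theorem fderiv_apply_const₂ {B : X → E →L[ℝ] F →L[ℝ] H} {x : X} (hB : DifferentiableAt ℝ B x)
    (v : E) (w : F) (u : X) : fderiv ℝ (fun z => B z v w) x u = fderiv ℝ B x u v w := by
  have h1 : DifferentiableAt ℝ (fun z => B z v) x := hB.clm_apply (differentiableAt_const v)
  rw [fderiv_apply_const h1, fderiv_apply_const hB]

end Calculus

section LeviCivita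

variable {E : Type*} [NormedAddCommGroup E] [NormedSpace ℝ E]

/-- `G` is a smooth field of nondegenerate symmetric forms on the open set `U`. -/
structure IsMetricOn (G : E → E →L[ℝ] E →L[ℝ] ℝ) (U : Set E) : Prop where
  isOpen : IsOpen U
  smooth : ContDiffOn ℝ ∞ G U
  symm : ∀ y ∈ U, ∀ v w, G y v w = G y w v
  inv : ∀ y ∈ U, (G y).IsInvertible

/-- The Christoffel symbols of the first kind, built from the first derivatives `T` of a metric;
the last index is the lowered one. -/
noncomputable def koszul (T : E →L[ℝ] E →L[ℝ] E →L[ℝ] ℝ) : E →L[ℝ] E →L[ℝ] E →L[ℝ] ℝ :=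
  (1 / 2 : ℝ) • (T + T.flip -
    ((ContinuousLinearMap.flipₗᵢ ℝ E E ℝ).toContinuousLinearEquiv :
      (E →L[ℝ] E →L[ℝ] ℝ) →L[ℝ] E →L[ℝ] E →L[ℝ] ℝ).comp T.flip)

theorem koszul_apply (T : E →L[ℝ] E →L[ℝ] E →L[ℝ] ℝ) (u v w : E) :
    koszul T u v w = 1 / 2 * (T u v w + T v u w - T w u v) := by
  simp [koszul]

/-- Raising an index with the metric `G`, as a linear map. Like `sharp` it is zero where `G y`
is not invertible. -/
noncomputable def sharpL (G : E → E →L[ℝ] E →L[ℝ] ℝ) (y : E) : (E →L[ℝ] ℝ) →L[ℝ] E :=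
  (G y).inverse

/-- The Christoffel symbols as a field of bilinear maps. -/
noncomputable def christoffelL (G : E → E →L[ℝ] E →L[ℝ] ℝ) (y : E) : E →L[ℝ] E →L[ℝ] E :=
  (ContinuousLinearMap.compL ℝ E (E →L[ℝ] ℝ) E (sharpL G y)).comp (koszul (fderiv ℝ G y))

section Sharp

variable {G : E → E →L[ℝ] E →L[ℝ] ℝ} {y : E}

theorem apply_sharpL (h : (G y).IsInvertible) (β : E →L[ℝ] ℝ) : G y (sharpL G y β) = β :=
  h.self_apply_inverse β

theorem sharpL_apply (h : (G y).IsInvertible) (v : E) : sharpL G y (G y v) = v :=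
  h.inverse_apply_self v

theorem eq_of_form_eq (h : (G y).IsInvertible) {v w : E} (hvw : ∀ z, G y v z = G y w z) :
    v = w :=
  h.injective (ContinuousLinearMap.ext hvw)

theorem eq_sharpL (h : (G y).IsInvertible) {v : E} {β : E →L[ℝ] ℝ}
    (hv : ∀ z, G y v z = β z) : v = sharpL G y β :=
  eq_of_form_eq h fun z => by rw [hv, apply_sharpL h]

end Sharp

namespace IsMetricOn

variable {G : E → E →L[ℝ] E →L[ℝ] ℝ} {U : Set E} {y : E}

theorem mono (hG : IsMetricOn G U) {V : Set E} (hV : IsOpen V) (hVU : V ⊆ U) :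
    IsMetricOn G V :=
  ⟨hV, hG.smooth.mono hVU, fun y hy => hG.symm y (hVU hy), fun y hy => hG.inv y (hVU hy)⟩

theorem contDiffAt (hG : IsMetricOn G U) (hy : y ∈ U) : ContDiffAt ℝ ∞ G y :=
  hG.smooth.contDiffAt (hG.isOpen.mem_nhds hy)

theorem differentiableAt (hG : IsMetricOn G U) (hy : y ∈ U) : DifferentiableAt ℝ G y :=
  (hG.contDiffAt hy).differentiableAt (by simp)

theorem smooth_fderiv (hG : IsMetricOn G U) : ContDiffOn ℝ ∞ (fderiv ℝ G) U :=
  hG.smooth.fderiv_of_isOpen hG.isOpen (by simp)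

theorem smooth_sharpL [CompleteSpace E] (hG : IsMetricOn G U) : ContDiffOn ℝ ∞ (sharpL G) U :=
  fun y hy => ((hG.inv y hy).contDiffAt_map_inverse.comp_contDiffWithinAt y (hG.smooth y hy))

theorem smooth_koszul (hG : IsMetricOn G U) :
    ContDiffOn ℝ ∞ (fun y => koszul (fderiv ℝ G y)) U := by
  have h := hG.smooth_fderiv
  have hflip : ContDiffOn ℝ ∞ (fun y => (fderiv ℝ G y).flip) U :=
    (ContinuousLinearMap.flipₗᵢ ℝ E E
      (E →L[ℝ] ℝ)).toContinuousLinearEquiv.contDiff.comp_contDiffOn h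
  exact ((h.add hflip).sub (contDiffOn_const.clm_comp hflip)).const_smul _

theorem smooth_christoffelL [CompleteSpace E] (hG : IsMetricOn G U) :
    ContDiffOn ℝ ∞ (christoffelL G) U :=
  ((ContinuousLinearMap.compL ℝ E (E →L[ℝ] ℝ) E).contDiff.comp_contDiffOn
    hG.smooth_sharpL).clm_comp hG.smooth_koszul

theorem differentiableAt_christoffelL [CompleteSpace E] (hG : IsMetricOn G U) (hy : y ∈ U) :
    DifferentiableAt ℝ (christoffelL G) y :=
  (hG.smooth_christoffelL.contDiffAt (hG.isOpen.mem_nhds hy)).differentiableAt (by simp)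

theorem fderiv_symm (hG : IsMetricOn G U) (hy : y ∈ U) (u v w : E) :
    fderiv ℝ G y u v w = fderiv ℝ G y u w v := by
  rw [← fderiv_apply_const₂ (hG.differentiableAt hy),
    ← fderiv_apply_const₂ (hG.differentiableAt hy)]
  have : (fun z => G z v w) =ᶠ[𝓝 y] fun z => G z w v := by
    filter_upwards [hG.isOpen.mem_nhds hy] with z hz using hG.symm z hz v w
  rw [this.fderiv_eq]

theorem form_christoffelL (hG : IsMetricOn G U) (hy : y ∈ U) (u v w : E) :
    G y (christoffelL G y u v) w =
      1 / 2 * (fderiv ℝ G y u v w + fderiv ℝ G y v u w - fderiv ℝ G y w u v) := by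
  change G y (sharpL G y (koszul (fderiv ℝ G y) u v)) w = _
  rw [apply_sharpL (hG.inv y hy), koszul_apply]

theorem christoffelL_symm (hG : IsMetricOn G U) (hy : y ∈ U) (u v : E) :
    christoffelL G y u v = christoffelL G y v u := by
  refine eq_of_form_eq (hG.inv y hy) fun w => ?_
  rw [hG.form_christoffelL hy, hG.form_christoffelL hy, hG.fderiv_symm hy w u v]
  ring

/-- Metric compatibility of the Levi-Civita connection. -/
theorem fderiv_form (hG : IsMetricOn G U) (hy : y ∈ U) (u v w : E) :
    fderiv ℝ G y u v w = G y (christoffelL G y u v) w + G y v (christoffelL G y u w) := by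
  rw [hG.symm y hy v, hG.form_christoffelL hy, hG.form_christoffelL hy, hG.fderiv_symm hy u w v,
    hG.fderiv_symm hy w u v]
  ring

/-- The Levi-Civita connection is the only torsion-free connection compatible with the metric. -/
theorem eq_christoffelL (hG : IsMetricOn G U) (hy : y ∈ U) {B : E → E → E}
    (hB : ∀ u v, B u v = B v u)
    (hB' : ∀ u v w, fderiv ℝ G y u v w = G y (B u v) w + G y v (B u w)) (u v : E) :
    B u v = christoffelL G y u v := by
  refine eq_of_form_eq (hG.inv y hy) fun w => ?_
  rw [hG.form_christoffelL hy, hB' u v w, hB' v u w, hB' w u v, hB v u, hB w u, hB w v,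
    hG.symm y hy v, hG.symm y hy u]
  ring

end IsMetricOn

/-- The curvature `R(u, v) w` in terms of the Christoffel symbols. -/
noncomputable def curvatureL (G : E → E →L[ℝ] E →L[ℝ] ℝ) (y : E) (u v w : E) : E :=
  fderiv ℝ (christoffelL G) y u v w - fderiv ℝ (christoffelL G) y v u w
    + christoffelL G y u (christoffelL G y v w) - christoffelL G y v (christoffelL G y u w)

/-- The endomorphism `u ↦ R(u, v) w`, whose trace is `Ric(v, w)`. -/
noncomputable def curvatureEnd (G : E → E →L[ℝ] E →L[ℝ] ℝ) (y : E) (v w : E) : E →ₗ[ℝ] E where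
  toFun u := curvatureL G y u v w
  map_add' a b := by simp [curvatureL]; abel
  map_smul' r a := by simp [curvatureL]; module

/-- The Ricci tensor. -/
noncomputable def ricciForm (G : E → E →L[ℝ] E →L[ℝ] ℝ) (y v w : E) : ℝ :=
  LinearMap.trace ℝ E (curvatureEnd G y v w)

end LeviCivita

end

/-! ### Curvature under isometries and conformal changes -/

section

theorem two_le_infty : minSmoothness ℝ 2 ≤ (∞ : WithTop ℕ∞) := by
  simp only [minSmoothness_of_isRCLikeNormedField]
  exact ENat.LEInfty.out

variable {E : Type*} [NormedAddCommGroup E] [NormedSpace ℝ E]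

/-- The map `F` is a local isometry from the metric `G` on `U` to the metric `H` on `V`. -/
structure IsIsometryOn (F : E → E) (G H : E → E →L[ℝ] E →L[ℝ] ℝ) (U V : Set E) : Prop where
  source : IsMetricOn G U
  target : IsMetricOn H V
  smooth : ContDiffOn ℝ ∞ F U
  mapsTo : MapsTo F U V
  inv : ∀ y ∈ U, (fderiv ℝ F y).IsInvertible
  form_eq : ∀ y ∈ U, ∀ v w, H (F y) (fderiv ℝ F y v) (fderiv ℝ F y w) = G y v w

namespace IsIsometryOn

variable {F : E → E} {G H : E → E →L[ℝ] E →L[ℝ] ℝ} {U V : Set E} {y : E}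

theorem hasFDerivAt (h : IsIsometryOn F G H U V) (hy : y ∈ U) :
    HasFDerivAt F (fderiv ℝ F y) y :=
  ((h.smooth.contDiffAt (h.source.isOpen.mem_nhds hy)).differentiableAt (by simp)).hasFDerivAt

theorem smooth_fderiv (h : IsIsometryOn F G H U V) : ContDiffOn ℝ ∞ (fderiv ℝ F) U :=
  h.smooth.fderiv_of_isOpen h.source.isOpen (by simp)

theorem hasFDerivAt_fderiv (h : IsIsometryOn F G H U V) (hy : y ∈ U) :
    HasFDerivAt (fderiv ℝ F) (fderiv ℝ (fderiv ℝ F) y) y :=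
  ((h.smooth_fderiv.contDiffAt (h.source.isOpen.mem_nhds hy)).differentiableAt
    (by simp)).hasFDerivAt

theorem hasFDerivAt_fderiv_fderiv (h : IsIsometryOn F G H U V) (hy : y ∈ U) :
    HasFDerivAt (fderiv ℝ (fderiv ℝ F)) (fderiv ℝ (fderiv ℝ (fderiv ℝ F)) y) y :=
  (((h.smooth_fderiv.fderiv_of_isOpen (m := ∞) h.source.isOpen (by simp)).contDiffAt
    (h.source.isOpen.mem_nhds hy)).differentiableAt (by simp)).hasFDerivAt

theorem fderiv_fderiv_symm (h : IsIsometryOn F G H U V) (hy : y ∈ U) (u v : E) :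
    fderiv ℝ (fderiv ℝ F) y u v = fderiv ℝ (fderiv ℝ F) y v u :=
  (h.smooth.contDiffAt (h.source.isOpen.mem_nhds hy)).isSymmSndFDerivAt
    two_le_infty u v

theorem fderiv₃_symm (h : IsIsometryOn F G H U V) (hy : y ∈ U) (u v : E) :
    fderiv ℝ (fderiv ℝ (fderiv ℝ F)) y u v = fderiv ℝ (fderiv ℝ (fderiv ℝ F)) y v u :=
  (h.smooth_fderiv.contDiffAt (h.source.isOpen.mem_nhds hy)).isSymmSndFDerivAt
    two_le_infty u v

theorem fderiv_form (h : IsIsometryOn F G H U V) (hy : y ∈ U) (u v w : E) :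
    fderiv ℝ G y u v w = fderiv ℝ H (F y) (fderiv ℝ F y u) (fderiv ℝ F y v) (fderiv ℝ F y w)
      + H (F y) (fderiv ℝ (fderiv ℝ F) y u v) (fderiv ℝ F y w)
      + H (F y) (fderiv ℝ F y v) (fderiv ℝ (fderiv ℝ F) y u w) := by
  have hev : (fun z => G z v w) =ᶠ[𝓝 y]
      fun z => H (F z) (fderiv ℝ F z v) (fderiv ℝ F z w) := by
    filter_upwards [h.source.isOpen.mem_nhds hy] with z hz using (h.form_eq z hz v w).symm
  have hH : HasFDerivAt (fun z => H (F z)) ((fderiv ℝ H (F y)).comp (fderiv ℝ F y)) y :=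
    (h.target.differentiableAt (h.mapsTo hy)).hasFDerivAt.comp y (h.hasFDerivAt hy)
  have hv := (h.hasFDerivAt_fderiv hy).clm_apply (hasFDerivAt_const v y)
  have hw := (h.hasFDerivAt_fderiv hy).clm_apply (hasFDerivAt_const w y)
  rw [← fderiv_apply_const₂ (h.source.differentiableAt hy), hev.fderiv_eq,
    ((hH.clm_apply hv).clm_apply hw).fderiv]
  simp
  ring

/-- Naturality of the Levi-Civita connection: it pulls back under `F` to a torsion-free connection
compatible with `G`. -/
theorem christoffelL_eq (h : IsIsometryOn F G H U V) (hy : y ∈ U) (u v : E) :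
    fderiv ℝ F y (christoffelL G y u v) =
      christoffelL H (F y) (fderiv ℝ F y u) (fderiv ℝ F y v) + fderiv ℝ (fderiv ℝ F) y u v := by
  have hinv := h.inv y hy
  have hFy := h.mapsTo hy
  rw [← h.source.eq_christoffelL hy (B := fun u v => (fderiv ℝ F y).inverse
    (christoffelL H (F y) (fderiv ℝ F y u) (fderiv ℝ F y v) + fderiv ℝ (fderiv ℝ F) y u v)),
    hinv.self_apply_inverse]
  · intro u v
    rw [h.target.christoffelL_symm hFy, h.fderiv_fderiv_symm hy]
  · intro u v w
    rw [h.fderiv_form hy, ← h.form_eq y hy, ← h.form_eq y hy, hinv.self_apply_inverse,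
      hinv.self_apply_inverse, h.target.fderiv_form hFy]
    simp only [map_add, add_apply]
    ring

/-- The derivative of `christoffelL_eq` in the direction `c`. -/
theorem fderiv_christoffelL [CompleteSpace E] (h : IsIsometryOn F G H U V) (hy : y ∈ U)
    (c a b : E) :
    fderiv ℝ (fderiv ℝ F) y c (christoffelL G y a b)
        + fderiv ℝ F y (fderiv ℝ (christoffelL G) y c a b) =
      fderiv ℝ (christoffelL H) (F y) (fderiv ℝ F y c) (fderiv ℝ F y a) (fderiv ℝ F y b)
        + christoffelL H (F y) (fderiv ℝ (fderiv ℝ F) y c a) (fderiv ℝ F y b)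
        + christoffelL H (F y) (fderiv ℝ F y a) (fderiv ℝ (fderiv ℝ F) y c b)
        + fderiv ℝ (fderiv ℝ (fderiv ℝ F)) y c a b := by
  have hev : (fun z => fderiv ℝ F z (christoffelL G z a b)) =ᶠ[𝓝 y] fun z =>
      christoffelL H (F z) (fderiv ℝ F z a) (fderiv ℝ F z b) + fderiv ℝ (fderiv ℝ F) z a b := by
    filter_upwards [h.source.isOpen.mem_nhds hy] with z hz using h.christoffelL_eq hz a b
  have hH : HasFDerivAt (fun z => christoffelL H (F z))
      ((fderiv ℝ (christoffelL H) (F y)).comp (fderiv ℝ F y)) y :=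
    (h.target.differentiableAt_christoffelL (h.mapsTo hy)).hasFDerivAt.comp y (h.hasFDerivAt hy)
  have hG := (h.source.differentiableAt_christoffelL hy).hasFDerivAt
  have ha := (h.hasFDerivAt_fderiv hy).clm_apply (hasFDerivAt_const a y)
  have hb := (h.hasFDerivAt_fderiv hy).clm_apply (hasFDerivAt_const b y)
  have h1 := (h.hasFDerivAt_fderiv hy).clm_apply
    ((hG.clm_apply (hasFDerivAt_const a y)).clm_apply (hasFDerivAt_const b y))
  have h2 := ((hH.clm_apply ha).clm_apply hb).add
    (((h.hasFDerivAt_fderiv_fderiv hy).clm_apply (hasFDerivAt_const a y)).clm_apply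
      (hasFDerivAt_const b y))
  have h3 := congrArg (fun L => L c) (h1.unique (h2.congr_of_eventuallyEq hev))
  simp at h3
  rw [add_comm, h3]
  abel

theorem curvatureL_eq [CompleteSpace E] (h : IsIsometryOn F G H U V) (hy : y ∈ U) (u v w : E) :
    fderiv ℝ F y (curvatureL G y u v w) =
      curvatureL H (F y) (fderiv ℝ F y u) (fderiv ℝ F y v) (fderiv ℝ F y w) := by
  have h1 := h.fderiv_christoffelL hy u v w
  have h2 := h.fderiv_christoffelL hy v u w
  rw [← eq_sub_iff_add_eq'] at h1 h2
  simp only [curvatureL, map_add, map_sub, h1, h2, h.christoffelL_eq hy]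
  rw [h.fderiv₃_symm hy u v, h.fderiv_fderiv_symm hy u v]
  abel

end IsIsometryOn

section Conformal

variable {G G' : E → E →L[ℝ] E →L[ℝ] ℝ} {ρ : E → ℝ} {U : Set E} {y : E}

/-- The metrics `G` and `G' = e^{2ρ} G` on `U` are conformal. -/
structure IsConformalOn (ρ : E → ℝ) (G G' : E → E →L[ℝ] E →L[ℝ] ℝ) (U : Set E) : Prop where
  source : IsMetricOn G U
  target : IsMetricOn G' U
  smooth : ContDiffOn ℝ ∞ ρ U
  form_eq : ∀ y ∈ U, ∀ v w, G' y v w = Real.exp (2 * ρ y) * G y v w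

/-- The change `M = -∇Υ + Υ ⊗ Υ - ½ |Υ|² g` of the Schouten tensor when the metric `g` is
multiplied by `e^{2ρ}`, where `Υ = dρ`. -/
noncomputable def schoutenChange (ρ : E → ℝ) (G : E → E →L[ℝ] E →L[ℝ] ℝ) (y : E) :
    E →L[ℝ] E →L[ℝ] ℝ :=
  -(fderiv ℝ (fderiv ℝ ρ) y
      - (ContinuousLinearMap.compL ℝ E E ℝ (fderiv ℝ ρ y)).comp (christoffelL G y))
    + (fderiv ℝ ρ y).smulRight (fderiv ℝ ρ y)
    - (1 / 2 * fderiv ℝ ρ y (sharpL G y (fderiv ℝ ρ y))) • G y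

theorem schoutenChange_apply (u v : E) :
    schoutenChange ρ G y u v = -(fderiv ℝ (fderiv ℝ ρ) y u v
      - fderiv ℝ ρ y (christoffelL G y u v)) + fderiv ℝ ρ y u * fderiv ℝ ρ y v
      - 1 / 2 * fderiv ℝ ρ y (sharpL G y (fderiv ℝ ρ y)) * G y u v := by
  simp [schoutenChange]

namespace IsConformalOn

theorem hasFDerivAt (h : IsConformalOn ρ G G' U) (hy : y ∈ U) :
    HasFDerivAt ρ (fderiv ℝ ρ y) y :=
  ((h.smooth.contDiffAt (h.source.isOpen.mem_nhds hy)).differentiableAt (by simp)).hasFDerivAt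

theorem smooth_fderiv (h : IsConformalOn ρ G G' U) : ContDiffOn ℝ ∞ (fderiv ℝ ρ) U :=
  h.smooth.fderiv_of_isOpen h.source.isOpen (by simp)

theorem hasFDerivAt_fderiv (h : IsConformalOn ρ G G' U) (hy : y ∈ U) :
    HasFDerivAt (fderiv ℝ ρ) (fderiv ℝ (fderiv ℝ ρ) y) y :=
  ((h.smooth_fderiv.contDiffAt (h.source.isOpen.mem_nhds hy)).differentiableAt
    (by simp)).hasFDerivAt

theorem fderiv_fderiv_symm (h : IsConformalOn ρ G G' U) (hy : y ∈ U) (u v : E) :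
    fderiv ℝ (fderiv ℝ ρ) y u v = fderiv ℝ (fderiv ℝ ρ) y v u :=
  (h.smooth.contDiffAt (h.source.isOpen.mem_nhds hy)).isSymmSndFDerivAt
    two_le_infty u v

theorem sharpL_eq (h : IsConformalOn ρ G G' U) (hy : y ∈ U) (β : E →L[ℝ] ℝ) :
    sharpL G' y β = Real.exp (-(2 * ρ y)) • sharpL G y β := by
  refine (eq_sharpL (h.target.inv y hy) fun z => ?_).symm
  rw [h.form_eq y hy]
  simp only [map_smul, smul_apply, apply_sharpL (h.source.inv y hy), smul_eq_mul]
  rw [← mul_assoc, ← Real.exp_add]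
  simp

/-- The Levi-Civita connection of `e^{2ρ} G`. -/
theorem christoffelL_eq (h : IsConformalOn ρ G G' U) (hy : y ∈ U) (u v : E) :
    christoffelL G' y u v = christoffelL G y u v + fderiv ℝ ρ y u • v + fderiv ℝ ρ y v • u
      - G y u v • sharpL G y (fderiv ℝ ρ y) := by
  symm
  refine h.target.eq_christoffelL hy (B := fun u v => christoffelL G y u v + fderiv ℝ ρ y u • v
    + fderiv ℝ ρ y v • u - G y u v • sharpL G y (fderiv ℝ ρ y)) (fun u v => ?_)
    (fun u v w => ?_) u v
  · rw [h.source.christoffelL_symm hy, h.source.symm y hy u v]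
    abel
  · have hev : (fun z => G' z v w) =ᶠ[𝓝 y] fun z => Real.exp (2 * ρ z) * G z v w := by
      filter_upwards [h.source.isOpen.mem_nhds hy] with z hz using h.form_eq z hz v w
    have h1 := ((h.hasFDerivAt hy).const_mul 2).exp
    have h2 := ((h.source.differentiableAt hy).hasFDerivAt.clm_apply
      (hasFDerivAt_const v y)).clm_apply (hasFDerivAt_const w y)
    rw [← fderiv_apply_const₂ (h.target.differentiableAt hy), hev.fderiv_eq]
    refine (DFunLike.congr_fun (h1.mul h2).fderiv u).trans ?_
    simp only [h.form_eq y hy, map_add, map_sub, map_smul, add_apply,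
      sub_apply, smul_apply,
      h.source.symm y hy v (sharpL G y _), apply_sharpL (h.source.inv y hy)]
    simp [h.source.fderiv_form hy u v w, h.source.symm y hy v u]
    ring

/-- The gradient `Z` of `ρ` is differentiable, with `∇_u Z` the vector dual to `∇_u dρ`. -/
theorem hasFDerivAt_gradient [CompleteSpace E] (h : IsConformalOn ρ G G' U) (hy : y ∈ U) :
    ∃ Z' : E →L[ℝ] E, HasFDerivAt (fun z => sharpL G z (fderiv ℝ ρ z)) Z' y ∧
      ∀ u, Z' u = sharpL G y (fderiv ℝ (fderiv ℝ ρ) y u -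
        (fderiv ℝ ρ y).comp (christoffelL G y u))
        - christoffelL G y u (sharpL G y (fderiv ℝ ρ y)) := by
  have hZ : DifferentiableAt ℝ (fun z => sharpL G z (fderiv ℝ ρ z)) y :=
    ((h.source.smooth_sharpL.contDiffAt (h.source.isOpen.mem_nhds hy)).differentiableAt
      (by simp)).clm_apply (h.hasFDerivAt_fderiv hy).differentiableAt
  refine ⟨_, hZ.hasFDerivAt, fun u => ?_⟩
  rw [eq_sub_iff_add_eq]
  refine eq_sharpL (h.source.inv y hy) fun w => ?_
  have hev : (fun z => G z (sharpL G z (fderiv ℝ ρ z)) w) =ᶠ[𝓝 y] fun z => fderiv ℝ ρ z w := by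
    filter_upwards [h.source.isOpen.mem_nhds hy] with z hz
    rw [apply_sharpL (h.source.inv z hz)]
  have h1 := ((h.source.differentiableAt hy).hasFDerivAt.clm_apply hZ.hasFDerivAt).clm_apply
    (hasFDerivAt_const w y)
  have h2 := (h.hasFDerivAt_fderiv hy).clm_apply (hasFDerivAt_const w y)
  have h3 := congrArg (fun L => L u) (h1.unique (h2.congr_of_eventuallyEq hev))
  simp [h.source.fderiv_form hy, apply_sharpL (h.source.inv y hy)] at h3
  simp
  linarith

/-- The curvature of `e^{2ρ} G` differs from that of `G` by the Kulkarni–Nomizu product of `G` with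
`schoutenChange`. -/
theorem curvatureL_eq [CompleteSpace E] (h : IsConformalOn ρ G G' U) (hy : y ∈ U) (u v w : E) :
    curvatureL G' y u v w = curvatureL G y u v w
      + schoutenChange ρ G y v w • u - schoutenChange ρ G y u w • v
      + G y v w • sharpL G y (schoutenChange ρ G y u)
      - G y u w • sharpL G y (schoutenChange ρ G y v) := by
  obtain ⟨Z', hZ', hZ⟩ := h.hasFDerivAt_gradient hy
  have hM (u : E) : sharpL G y (schoutenChange ρ G y u) = -(Z' u
      + christoffelL G y u (sharpL G y (fderiv ℝ ρ y)))
      + fderiv ℝ ρ y u • sharpL G y (fderiv ℝ ρ y)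
      - (1 / 2 * fderiv ℝ ρ y (sharpL G y (fderiv ℝ ρ y))) • u := by
    rw [hZ, sub_add_cancel]
    have hu : schoutenChange ρ G y u = -(fderiv ℝ (fderiv ℝ ρ) y u
        - (fderiv ℝ ρ y).comp (christoffelL G y u)) + fderiv ℝ ρ y u • fderiv ℝ ρ y
        - (1 / 2 * fderiv ℝ ρ y (sharpL G y (fderiv ℝ ρ y))) • G y u := by
      ext w
      simp [schoutenChange]
    rw [hu, map_sub, map_add, map_neg, map_smul, map_smul, sharpL_apply (h.source.inv y hy)]
  have hΓ (u v w : E) : fderiv ℝ (christoffelL G') y u v w = fderiv ℝ (christoffelL G) y u v w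
      + fderiv ℝ (fderiv ℝ ρ) y u v • w + fderiv ℝ (fderiv ℝ ρ) y u w • v
      - (fderiv ℝ G y u v w • sharpL G y (fderiv ℝ ρ y) + G y v w • Z' u) := by
    have hev : (fun z => christoffelL G' z v w) =ᶠ[𝓝 y] fun z =>
        christoffelL G z v w + fderiv ℝ ρ z v • w + fderiv ℝ ρ z w • v
          - G z v w • sharpL G z (fderiv ℝ ρ z) := by
      filter_upwards [h.source.isOpen.mem_nhds hy] with z hz using h.christoffelL_eq hz v w
    have h1 := ((h.source.differentiableAt_christoffelL hy).hasFDerivAt.clm_apply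
      (hasFDerivAt_const v y)).clm_apply (hasFDerivAt_const w y)
    have h2 := ((h.hasFDerivAt_fderiv hy).clm_apply (hasFDerivAt_const v y)).smul
      (hasFDerivAt_const w y)
    have h3 := ((h.hasFDerivAt_fderiv hy).clm_apply (hasFDerivAt_const w y)).smul
      (hasFDerivAt_const v y)
    have h4 := (((h.source.differentiableAt hy).hasFDerivAt.clm_apply
      (hasFDerivAt_const v y)).clm_apply (hasFDerivAt_const w y)).smul hZ'
    rw [← fderiv_apply_const₂ (h.target.differentiableAt_christoffelL hy), hev.fderiv_eq]
    refine (DFunLike.congr_fun (((h1.add h2).add h3).sub h4).fderiv u).trans ?_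
    simp
    abel
  have hs (v : E) : G y v (sharpL G y (fderiv ℝ ρ y)) = fderiv ℝ ρ y v := by
    rw [h.source.symm y hy, apply_sharpL (h.source.inv y hy)]
  simp only [curvatureL, hM, hΓ, h.christoffelL_eq hy, schoutenChange_apply,
    h.source.fderiv_form hy, h.fderiv_fderiv_symm hy u v, map_add, map_sub, map_smul, hs,
    smul_eq_mul, h.source.symm y hy v u,
    h.source.christoffelL_symm hy v u, h.source.symm y hy v (christoffelL G y u w)]
  module

end IsConformalOn

end Conformal

end

/-! ### The Schouten tensor -/

section

variable {E : Type*} [NormedAddCommGroup E] [NormedSpace ℝ E]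

/-- The Ricci tensor as a bilinear map. -/
noncomputable def ricciL (G : E → E →L[ℝ] E →L[ℝ] ℝ) (y : E) : E →ₗ[ℝ] E →ₗ[ℝ] ℝ :=
  LinearMap.mk₂ ℝ (ricciForm G y)
    (fun v v' w => by
      rw [ricciForm, ricciForm, ricciForm, ← map_add]
      congr 1
      ext u
      simp [curvatureEnd, curvatureL]
      abel)
    (fun r v w => by
      rw [ricciForm, ricciForm, ← map_smul]
      congr 1
      ext u
      simp [curvatureEnd, curvatureL]
      module)
    (fun v w w' => by
      rw [ricciForm, ricciForm, ricciForm, ← map_add]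
      congr 1
      ext u
      simp [curvatureEnd, curvatureL]
      abel)
    (fun r v w => by
      rw [ricciForm, ricciForm, ← map_smul]
      congr 1
      ext u
      simp [curvatureEnd, curvatureL]
      module)

theorem ricciL_apply (G : E → E →L[ℝ] E →L[ℝ] ℝ) (y v w : E) :
    ricciL G y v w = LinearMap.trace ℝ E (curvatureEnd G y v w) := rfl

theorem IsIsometryOn.ricciL_eq {F : E → E} {G H : E → E →L[ℝ] E →L[ℝ] ℝ} {U V : Set E} {y : E}
    [CompleteSpace E] (h : IsIsometryOn F G H U V) (hy : y ∈ U) (v w : E) :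
    ricciL H (F y) (fderiv ℝ F y v) (fderiv ℝ F y w) = ricciL G y v w := by
  obtain ⟨e, he⟩ := h.inv y hy
  rw [ricciL_apply, ricciL_apply, ← LinearMap.trace_conj' (curvatureEnd G y v w) e.toLinearEquiv]
  congr 1
  ext u
  have h1 := h.curvatureL_eq hy (e.symm u) v w
  rw [← he] at h1
  rw [← he]
  simp only [ContinuousLinearEquiv.coe_coe, ContinuousLinearEquiv.apply_symm_apply] at h1
  exact h1.symm

variable [FiniteDimensional ℝ E]

/-- The Ricci endomorphism, obtained from the Ricci tensor by raising an index. -/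
noncomputable def ricciEnd (G : E → E →L[ℝ] E →L[ℝ] ℝ) (y : E) : E →ₗ[ℝ] E :=
  (sharpL G y).toLinearMap ∘ₗ
    (LinearMap.toContinuousLinearMap (𝕜 := ℝ) (E := E) (F' := ℝ)).toLinearMap ∘ₗ ricciL G y

/-- The scalar curvature, as the trace of the Ricci endomorphism. -/
noncomputable def scalarL (G : E → E →L[ℝ] E →L[ℝ] ℝ) (y : E) : ℝ :=
  LinearMap.trace ℝ E (ricciEnd G y)

/-- The Schouten tensor as a bilinear map. -/
noncomputable def schoutenL (G : E → E →L[ℝ] E →L[ℝ] ℝ) (y : E) : E →ₗ[ℝ] E →ₗ[ℝ] ℝ :=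
  (1 / ((Module.finrank ℝ E : ℝ) - 2)) •
    (ricciL G y - (scalarL G y / (2 * ((Module.finrank ℝ E : ℝ) - 1))) • (G y).toLinearMap₁₂)

theorem schoutenL_apply (G : E → E →L[ℝ] E →L[ℝ] ℝ) (y v w : E) :
    schoutenL G y v w = (1 / ((Module.finrank ℝ E : ℝ) - 2)) *
      (ricciL G y v w - scalarL G y / (2 * ((Module.finrank ℝ E : ℝ) - 1)) * G y v w) := by
  simp [schoutenL]

theorem form_ricciEnd {G : E → E →L[ℝ] E →L[ℝ] ℝ} {y : E} (h : (G y).IsInvertible) (v w : E) :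
    G y (ricciEnd G y v) w = ricciL G y v w := by
  change G y (sharpL G y (LinearMap.toContinuousLinearMap (ricciL G y v))) w = _
  rw [apply_sharpL h]
  rfl

namespace IsIsometryOn

variable {F : E → E} {G H : E → E →L[ℝ] E →L[ℝ] ℝ} {U V : Set E} {y : E} [CompleteSpace E]

theorem scalarL_eq (h : IsIsometryOn F G H U V) (hy : y ∈ U) :
    scalarL H (F y) = scalarL G y := by
  obtain ⟨e, he⟩ := h.inv y hy
  rw [scalarL, scalarL, ← LinearMap.trace_conj' (ricciEnd G y) e.toLinearEquiv]
  congr 1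
  ext u
  have hH := h.target.inv _ (h.mapsTo hy)
  refine eq_of_form_eq hH fun z => ?_
  rw [form_ricciEnd hH]
  have h1 := h.ricciL_eq hy (e.symm u) (e.symm z)
  have h2 := h.form_eq y hy (ricciEnd G y (e.symm u)) (e.symm z)
  rw [form_ricciEnd (h.source.inv y hy), ← h1, ← he] at h2
  simpa using h2.symm

theorem schoutenL_eq (h : IsIsometryOn F G H U V) (hy : y ∈ U) (v w : E) :
    schoutenL H (F y) (fderiv ℝ F y v) (fderiv ℝ F y w) = schoutenL G y v w := by
  rw [schoutenL_apply, schoutenL_apply, h.ricciL_eq hy, h.scalarL_eq hy, h.form_eq y hy]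

end IsIsometryOn

namespace IsConformalOn

variable {G G' : E → E →L[ℝ] E →L[ℝ] ℝ} {ρ : E → ℝ} {U : Set E} {y : E} [CompleteSpace E]

theorem ricciL_eq (h : IsConformalOn ρ G G' U) (hy : y ∈ U) (v w : E) :
    ricciL G' y v w = ricciL G y v w
      + ((Module.finrank ℝ E : ℝ) - 2) * schoutenChange ρ G y v w
      + LinearMap.trace ℝ E ((sharpL G y).comp (schoutenChange ρ G y)).toLinearMap * G y v w := by
  have hc : curvatureEnd G' y v w = curvatureEnd G y v w
      + schoutenChange ρ G y v w • LinearMap.id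
      - ((schoutenChange ρ G y).flip w).toLinearMap.smulRight v
      + G y v w • ((sharpL G y).comp (schoutenChange ρ G y)).toLinearMap
      - ((G y).flip w).toLinearMap.smulRight (sharpL G y (schoutenChange ρ G y v)) := by
    ext u
    simpa [curvatureEnd] using h.curvatureL_eq hy u v w
  rw [ricciL_apply, ricciL_apply, hc]
  simp only [map_add, map_sub, map_smul, LinearMap.trace_smulRight, LinearMap.trace_id, smul_eq_mul,
    ContinuousLinearMap.coe_coe, ContinuousLinearMap.flip_apply,
    apply_sharpL (h.source.inv y hy)]
  ring

theorem scalarL_eq (h : IsConformalOn ρ G G' U) (hy : y ∈ U) :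
    scalarL G' y = Real.exp (-(2 * ρ y)) * (scalarL G y + 2 * ((Module.finrank ℝ E : ℝ) - 1) *
      LinearMap.trace ℝ E ((sharpL G y).comp (schoutenChange ρ G y)).toLinearMap) := by
  have hR : ricciEnd G' y = Real.exp (-(2 * ρ y)) • (ricciEnd G y
      + ((Module.finrank ℝ E : ℝ) - 2) • ((sharpL G y).comp (schoutenChange ρ G y)).toLinearMap
      + LinearMap.trace ℝ E ((sharpL G y).comp (schoutenChange ρ G y)).toLinearMap •
        LinearMap.id) := by
    ext v
    refine eq_of_form_eq (h.target.inv y hy) fun w => ?_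
    rw [form_ricciEnd (h.target.inv y hy), h.ricciL_eq hy, h.form_eq y hy]
    simp only [LinearMap.smul_apply, LinearMap.add_apply, map_smul, map_add,
      smul_apply, add_apply, smul_eq_mul,
      form_ricciEnd (h.source.inv y hy), ContinuousLinearMap.coe_coe,
      ContinuousLinearMap.comp_apply, apply_sharpL (h.source.inv y hy), LinearMap.id_apply]
    rw [← mul_assoc, ← Real.exp_add]
    simp
  rw [scalarL, scalarL, hR]
  simp only [map_add, map_smul, LinearMap.trace_id, smul_eq_mul]
  ring

/-- The Schouten tensor is the trace adjustment of the Ricci tensor whose conformal change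
involves no trace of `schoutenChange`. -/
theorem schoutenL_eq (h : IsConformalOn ρ G G' U) (hy : y ∈ U)
    (hn : 3 ≤ Module.finrank ℝ E) (v w : E) :
    schoutenL G' y v w = schoutenL G y v w + schoutenChange ρ G y v w := by
  have hn' : (3 : ℝ) ≤ Module.finrank ℝ E := by exact_mod_cast hn
  have h1 : (Module.finrank ℝ E : ℝ) - 2 ≠ 0 := by linarith
  have h2 : (Module.finrank ℝ E : ℝ) - 1 ≠ 0 := by linarith
  have he : Real.exp (-(2 * ρ y)) * Real.exp (2 * ρ y) = 1 := by
    rw [← Real.exp_add]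
    simp
  have key (s t : ℝ) : Real.exp (-(2 * ρ y)) * s / t * (Real.exp (2 * ρ y) * G y v w)
      = s / t * G y v w := by
    linear_combination (s / t * G y v w) * he
  rw [schoutenL_apply, schoutenL_apply, h.ricciL_eq hy, h.scalarL_eq hy, h.form_eq y hy, key]
  field_simp
  ring

end IsConformalOn

section Coordinates

variable {n : ℕ} {G : FormField n} {U : Set (Coord n)} {y : Coord n}

theorem sharp_eq_sharpL (G : FormField n) (y : Coord n) (β : Coord n →L[ℝ] ℝ) :
    sharp G y β = sharpL G y β := rfl

theorem trace_eq_sum_coord (A : Coord n →ₗ[ℝ] Coord n) :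
    LinearMap.trace ℝ (Coord n) A = ∑ i, A (EuclideanSpace.single i 1) i := by
  rw [LinearMap.trace_eq_matrix_trace ℝ (EuclideanSpace.basisFun (Fin n) ℝ).toBasis, Matrix.trace]
  simp [LinearMap.toMatrix_apply]

namespace IsMetricOn

theorem christoffel_eq (hG : IsMetricOn G U) (hy : y ∈ U) (u v : Coord n) :
    christoffel G y u v = christoffelL G y u v := by
  change _ = sharp G y (koszul (fderiv ℝ G y) u v)
  rw [christoffel]
  congr 1
  ext w
  rw [koszul_apply]
  simp [fderiv_apply_const₂ (hG.differentiableAt hy)]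

theorem curvature_eq (hG : IsMetricOn G U) (hy : y ∈ U) (u v w : Coord n) :
    curvature G y u v w = curvatureL G y u v w := by
  have hd := hG.differentiableAt_christoffelL hy
  have h (a b : Coord n) :
      (fun z => christoffel G z a b) =ᶠ[𝓝 y] fun z => christoffelL G z a b := by
    filter_upwards [hG.isOpen.mem_nhds hy] with z hz using hG.christoffel_eq hz a b
  rw [curvature, (h v w).fderiv_eq, (h u w).fderiv_eq, fderiv_apply_const₂ hd,
    fderiv_apply_const₂ hd]
  simp only [hG.christoffel_eq hy, curvatureL]

theorem ricci_eq (hG : IsMetricOn G U) (hy : y ∈ U) (v w : Coord n) :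
    ricci G y v w = ricciL G y v w := by
  rw [ricciL_apply, trace_eq_sum_coord, ricci]
  simp only [hG.curvature_eq hy]
  rfl

theorem scalarCurvature_eq (hG : IsMetricOn G U) (hy : y ∈ U) :
    scalarCurvature G y = scalarL G y := by
  rw [scalarCurvature, scalarL, trace_eq_sum_coord]
  refine Finset.sum_congr rfl fun i _ => ?_
  have hinv := hG.inv y hy
  rw [hG.ricci_eq hy, ← form_ricciEnd hinv, hG.symm y hy, sharp_eq_sharpL, apply_sharpL hinv]
  rfl

theorem schouten_eq (hG : IsMetricOn G U) (hy : y ∈ U) (v w : Coord n) :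
    schouten G y v w = schoutenL G y v w := by
  rw [schouten, schoutenL_apply, hG.ricci_eq hy, hG.scalarCurvature_eq hy,
    finrank_euclideanSpace_fin]

end IsMetricOn

end Coordinates

end

/-! ### Invariance of the conformal circle system -/

section

variable {E : Type*} [NormedAddCommGroup E] [NormedSpace ℝ E]

section Curve

variable {x : ℝ → E} {t : ℝ}

theorem hasDerivAt_of_contDiffAt_two (hx : ContDiffAt ℝ 2 x t) : HasDerivAt x (deriv x t) t :=
  (hx.differentiableAt (by simp)).hasDerivAt

theorem eventually_hasDerivAt (hx : ContDiffAt ℝ 2 x t) :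
    ∀ᶠ s in 𝓝 t, HasDerivAt x (deriv x s) s := by
  filter_upwards [hx.eventually (by simp)] with s hs using hasDerivAt_of_contDiffAt_two hs

theorem hasDerivAt_deriv (hx : ContDiffAt ℝ 2 x t) :
    HasDerivAt (deriv x) (deriv (deriv x) t) t := by
  have h : ContDiffAt ℝ 1 (deriv x) t := by
    have := (hx.fderiv_right (m := 1) (by norm_num)).clm_apply (contDiffAt_const (c := (1 : ℝ)))
    exact this
  exact (h.differentiableAt (by simp)).hasDerivAt

end Curve

theorem deriv_deriv_comp {F : E → E} {x : ℝ → E} {t : ℝ} (hF : ContDiffAt ℝ 2 F (x t))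
    (hx : ContDiffAt ℝ 2 x t) :
    deriv (fun s => F (x s)) =ᶠ[𝓝 t] (fun s => fderiv ℝ F (x s) (deriv x s)) ∧
    deriv (deriv fun s => F (x s)) t = fderiv ℝ (fderiv ℝ F) (x t) (deriv x t) (deriv x t)
      + fderiv ℝ F (x t) (deriv (deriv x) t) := by
  have h1 : deriv (fun s => F (x s)) =ᶠ[𝓝 t] (fun s => fderiv ℝ F (x s) (deriv x s)) := by
    filter_upwards [eventually_hasDerivAt hx,
      hx.continuousAt.eventually (hF.eventually (by simp))] with s hs hFs
    exact ((hFs.differentiableAt (by simp)).hasFDerivAt.comp_hasDerivAt s hs).deriv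
  refine ⟨h1, ?_⟩
  have hF' : DifferentiableAt ℝ (fderiv ℝ F) (x t) :=
    (hF.fderiv_right (m := 1) (by norm_num)).differentiableAt (by simp)
  rw [h1.deriv_eq]
  exact ((hF'.hasFDerivAt.comp_hasDerivAt t
    (hasDerivAt_of_contDiffAt_two hx)).clm_apply (hasDerivAt_deriv hx)).deriv

theorem IsIsometryOn.contDiffAt {F : E → E} {G H : E → E →L[ℝ] E →L[ℝ] ℝ} {U V : Set E}
    (h : IsIsometryOn F G H U V) {y : E} (hy : y ∈ U) : ContDiffAt ℝ ∞ F y :=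
  h.smooth.contDiffAt (h.source.isOpen.mem_nhds hy)

variable [FiniteDimensional ℝ E]

theorem hasDerivAt_clm_of_apply {β : ℝ → E →L[ℝ] ℝ} {β' : E →L[ℝ] ℝ} {t : ℝ}
    (h : ∀ w, HasDerivAt (fun s => β s w) (β' w) t) : HasDerivAt β β' t := by
  let b := Module.finBasis ℝ E
  have hsum (γ : E →L[ℝ] ℝ) : γ = ∑ i, γ (b i) • LinearMap.toContinuousLinearMap (b.coord i) := by
    ext w
    calc γ w = γ (∑ i, b.repr w i • b i) := by rw [b.sum_repr]
      _ = _ := by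
        rw [map_sum]
        simp [mul_comm]
  rw [hsum β', show β = fun s => ∑ i, β s (b i) • LinearMap.toContinuousLinearMap (b.coord i) from
    funext fun s => hsum (β s)]
  exact HasDerivAt.fun_sum fun i _ => (h (b i)).smul_const _

/-- The time derivative of the `1`-form in the conformal circle system, at the position `y`, with
velocity `u` and `1`-form `β`. -/
noncomputable def formRate (G : E → E →L[ℝ] E →L[ℝ] ℝ) (y u : E) (β : E →L[ℝ] ℝ) : E →L[ℝ] ℝ :=
  β.comp (christoffelL G y u) + (β u • β - (1 / 2 * β (sharpL G y β)) • G y u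
    + LinearMap.toContinuousLinearMap (schoutenL G y u))

theorem formRate_apply (G : E → E →L[ℝ] E →L[ℝ] ℝ) (y u : E) (β : E →L[ℝ] ℝ) (w : E) :
    formRate G y u β w = β (christoffelL G y u w)
      + (β u * β w - 1 / 2 * β (sharpL G y β) * G y u w + schoutenL G y u w) := by
  simp [formRate]

/-- The covariant acceleration `∇_u u` of a curve with velocity `u`. -/
noncomputable def covAccel (G : E → E →L[ℝ] E →L[ℝ] ℝ) (x : ℝ → E) (t : ℝ) : E :=
  deriv (deriv x) t + christoffelL G (x t) (deriv x t) (deriv x t)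

/-- The conformal circle system, with the equation for the `1`-form `β` stated for `β` itself
instead of for its values on constant vectors. -/
structure CircleSystemL (G : E → E →L[ℝ] E →L[ℝ] ℝ) (x : ℝ → E) (β : ℝ → E →L[ℝ] ℝ)
    (t : ℝ) : Prop where
  accel : covAccel G x t = -((2 * β t (deriv x t)) • deriv x t
    - G (x t) (deriv x t) (deriv x t) • sharpL G (x t) (β t))
  form : HasDerivAt β (formRate G (x t) (deriv x t) (β t)) t

theorem CircleSystemL.congr {G : E → E →L[ℝ] E →L[ℝ] ℝ} {x x' : ℝ → E}
    {β β' : ℝ → E →L[ℝ] ℝ} {t : ℝ} (h : CircleSystemL G x β t) (hx : x' =ᶠ[𝓝 t] x)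
    (hβ : β' =ᶠ[𝓝 t] β) : CircleSystemL G x' β' t := by
  have h1 := hx.eq_of_nhds
  have h2 := hx.deriv.eq_of_nhds
  have h3 := hx.deriv.deriv.eq_of_nhds
  have h4 := hβ.eq_of_nhds
  refine ⟨?_, ?_⟩
  · have := h.accel
    rw [covAccel] at this ⊢
    rw [h1, h2, h3, h4, this]
  · rw [h1, h2, h4]
    exact h.form.congr_of_eventuallyEq hβ

theorem circleSystemAt_iff {n : ℕ} {G : FormField n} {U : Set (Coord n)} (hG : IsMetricOn G U)
    {x : ℝ → Coord n} {β : ℝ → Coord n →L[ℝ] ℝ} {t : ℝ} (hx : x t ∈ U) :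
    CircleSystemAt G x β t ↔ CircleSystemL G x β t := by
  have h (w : Coord n) : β t (christoffel G (x t) (deriv x t) w)
        + (β t (deriv x t) * β t w - 1 / 2 * β t (sharp G (x t) (β t)) * G (x t) (deriv x t) w
          + schouten G (x t) (deriv x t) w) = formRate G (x t) (deriv x t) (β t) w := by
    rw [formRate_apply, hG.christoffel_eq hx, hG.schouten_eq hx, sharp_eq_sharpL]
  constructor
  · rintro ⟨h1, h2⟩
    refine ⟨?_, hasDerivAt_clm_of_apply fun w => ?_⟩
    · rw [hG.christoffel_eq hx] at h1
      exact h1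
    · rw [← h]
      exact h2 w
  · rintro ⟨h1, h2⟩
    refine ⟨?_, fun w => ?_⟩
    · rw [hG.christoffel_eq hx]
      exact h1
    · rw [h]
      simpa using h2.clm_apply (hasDerivAt_const t w)

/-- Conformal invariance: under the change from `G` to `e^{2ρ} G` the `1`-form `β` is replaced by
`β - dρ`. -/
theorem IsConformalOn.circleSystemL {G G' : E → E →L[ℝ] E →L[ℝ] ℝ} {ρ : E → ℝ} {U : Set E}
    [CompleteSpace E] (h : IsConformalOn ρ G G' U) (hn : 3 ≤ Module.finrank ℝ E) {x : ℝ → E}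
    {β : ℝ → E →L[ℝ] ℝ} {t : ℝ} (hxt : x t ∈ U) (hx : ContDiffAt ℝ 2 x t)
    (hc : CircleSystemL G x β t) : CircleSystemL G' x (fun s => β s - fderiv ℝ ρ (x s)) t := by
  have hinv := h.source.inv _ hxt
  have hs (v : E) : G (x t) v (sharpL G (x t) (fderiv ℝ ρ (x t))) = fderiv ℝ ρ (x t) v := by
    rw [h.source.symm _ hxt, apply_sharpL hinv]
  have he : Real.exp (2 * ρ (x t)) * Real.exp (-(2 * ρ (x t))) = 1 := by
    rw [← Real.exp_add]
    simp
  have hsβ : β t (sharpL G (x t) (fderiv ℝ ρ (x t)))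
      = fderiv ℝ ρ (x t) (sharpL G (x t) (β t)) := by
    rw [← hs (sharpL G (x t) (β t)), apply_sharpL hinv]
  refine ⟨?_, ?_⟩
  · have h1 := hc.accel
    rw [covAccel] at h1 ⊢
    rw [h.christoffelL_eq hxt, h.form_eq _ hxt, h.sharpL_eq hxt, map_sub, smul_smul,
      mul_right_comm, he]
    rw [← eq_sub_iff_add_eq] at h1
    rw [h1]
    simp only [sub_apply]
    module
  · have h1 := hc.form.sub ((h.hasFDerivAt_fderiv hxt).comp_hasDerivAt t
      (hasDerivAt_of_contDiffAt_two hx))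
    refine h1.congr_deriv ?_
    ext w
    simp only [sub_apply, formRate_apply, h.schoutenL_eq hxt hn, h.christoffelL_eq hxt,
      h.form_eq _ hxt, h.sharpL_eq hxt, schoutenChange_apply, map_add, map_sub, map_smul,
      smul_eq_mul, hsβ]
    linear_combination (1 / 2 * G (x t) (deriv x t) w * (β t (sharpL G (x t) (β t))
      - 2 * fderiv ℝ ρ (x t) (sharpL G (x t) (β t))
      + fderiv ℝ ρ (x t) (sharpL G (x t) (fderiv ℝ ρ (x t))))) * he

namespace IsIsometryOn

variable {F : E → E} {G H : E → E →L[ℝ] E →L[ℝ] ℝ} {U V : Set E} [CompleteSpace E]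

/-- Naturality of the conformal circle system. -/
theorem circleSystemL (h : IsIsometryOn F G H U V) {x : ℝ → E} {β : ℝ → E →L[ℝ] ℝ} {t : ℝ}
    (hxt : x t ∈ U) (hx : ContDiffAt ℝ 2 x t) (hc : CircleSystemL G x β t) :
    CircleSystemL H (fun s => F (x s)) (fun s => (β s).comp (fderiv ℝ F (x s)).inverse) t := by
  obtain ⟨hd1, hd2⟩ := deriv_deriv_comp ((h.contDiffAt hxt).of_le ENat.LEInfty.out) hx
  have hd1 := hd1.eq_of_nhds
  have hinv := h.inv _ hxt
  have hH := h.target.inv _ (h.mapsTo hxt)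
  have hsharp : sharpL H (F (x t)) ((β t).comp (fderiv ℝ F (x t)).inverse)
      = fderiv ℝ F (x t) (sharpL G (x t) (β t)) := by
    symm
    refine eq_sharpL hH fun z => ?_
    obtain ⟨w, rfl⟩ := hinv.surjective z
    rw [h.form_eq _ hxt, apply_sharpL (h.source.inv _ hxt)]
    simp [hinv.inverse_apply_self]
  refine ⟨?_, ?_⟩
  · have h1 := congrArg (fderiv ℝ F (x t)) hc.accel
    rw [covAccel, map_add, h.christoffelL_eq hxt] at h1
    rw [covAccel, hd2]
    simp only [hd1]
    rw [hsharp, h.form_eq _ hxt]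
    simp only [ContinuousLinearMap.comp_apply, hinv.inverse_apply_self]
    rw [add_assoc, add_comm, add_assoc, h1]
    simp
  · refine hasDerivAt_clm_of_apply fun z => ?_
    obtain ⟨w, rfl⟩ := hinv.surjective z
    -- The vector `(DF)⁻¹ (DF (x t) w)` along the curve is differentiated implicitly, through `DF`.
    have hI : DifferentiableAt ℝ (fun y => (fderiv ℝ F y).inverse) (x t) :=
      ((hinv.contDiffAt_map_inverse (n := ∞)).comp (x t) (h.smooth_fderiv.contDiffAt
        (h.source.isOpen.mem_nhds hxt))).differentiableAt (by simp)
    have hx1 := hasDerivAt_of_contDiffAt_two hx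
    have h1 := (hI.hasFDerivAt.comp_hasDerivAt t hx1).clm_apply
      (hasDerivAt_const t (fderiv ℝ F (x t) w))
    have h2 := ((h.hasFDerivAt_fderiv hxt).comp_hasDerivAt t hx1).clm_apply h1
    have h3 : (fun s => fderiv ℝ F (x s) ((fderiv ℝ F (x s)).inverse (fderiv ℝ F (x t) w)))
        =ᶠ[𝓝 t] fun _ => fderiv ℝ F (x t) w := by
      filter_upwards [hx.continuousAt.eventually (h.source.isOpen.mem_nhds hxt)] with s hs
      rw [(h.inv _ hs).self_apply_inverse]
    have h4 := h2.unique ((hasDerivAt_const t (fderiv ℝ F (x t) w)).congr_of_eventuallyEq h3)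
    simp only [Function.comp_apply, hinv.inverse_apply_self, map_zero, add_zero] at h4
    have h5 := congrArg (fderiv ℝ F (x t)).inverse (eq_neg_of_add_eq_zero_right h4)
    rw [hinv.inverse_apply_self] at h5
    refine (hc.form.clm_apply h1).congr_deriv ?_
    simp only [Function.comp_apply, hinv.inverse_apply_self, map_zero, add_zero, h5, hd1,
      formRate_apply, ContinuousLinearMap.comp_apply, h.form_eq _ hxt, h.schoutenL_eq hxt,
      hsharp, map_neg]
    have h6 := congrArg (fderiv ℝ F (x t)).inverse (h.christoffelL_eq hxt (deriv x t) w)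
    rw [hinv.inverse_apply_self, map_add, ← sub_eq_iff_eq_add] at h6
    rw [← h6, map_sub]
    ring

end IsIsometryOn

end

/-! ### The third-order equation of unparametrized conformal circles -/

section

variable {E : Type*} [NormedAddCommGroup E] [NormedSpace ℝ E]

theorem contDiffAt_deriv {x : ℝ → E} {t : ℝ} {m k : WithTop ℕ∞} (hx : ContDiffAt ℝ k x t)
    (hm : m + 1 ≤ k) : ContDiffAt ℝ m (deriv x) t :=
  (hx.fderiv_right hm).clm_apply (contDiffAt_const (c := (1 : ℝ)))

theorem two_le_three_smooth : (2 : WithTop ℕ∞) ≤ 3 := by exact_mod_cast (by norm_num : 2 ≤ 3)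

theorem hasDerivAt_deriv_deriv {x : ℝ → E} {t : ℝ} (hx : ContDiffAt ℝ 3 x t) :
    HasDerivAt (deriv (deriv x)) (deriv (deriv (deriv x)) t) t :=
  hasDerivAt_deriv (contDiffAt_deriv hx (by norm_num))

/-- Here `X` is a third derivative and `a` a second derivative of a curve with velocity `u`, and
the two equations are those of the curve and of its image. The terms of degree two in `a` are
isolated by adding the equations for `a` and `-a` and subtracting twice the one for `0`. -/
theorem quadratic_part_eq {D : E →L[ℝ] E} {L₁ L₂ : E →L[ℝ] E} {k₁ k₂ e₁ e₂ u : E}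
    {γ₁ γ₂ : E →L[ℝ] ℝ} {g₁ g₂ : ℝ}
    (h : ∀ a, ∃ (X : E) (μ ν : ℝ), X + L₁ a + k₁ = (3 * γ₁ (a + e₁) / g₁) • (a + e₁) + μ • u ∧
      D X + L₂ a + k₂ = (3 * γ₂ (D a + e₂) / g₂) • (D a + e₂) + ν • D u) (a : E) :
    ∃ c : ℝ, (γ₁ a / g₁ - γ₂ (D a) / g₂) • D a = c • D u := by
  obtain ⟨X, μ, ν, h1, h2⟩ := h a
  obtain ⟨X', μ', ν', h1', h2'⟩ := h (-a)
  obtain ⟨X₀, μ₀, ν₀, h1₀, h2₀⟩ := h 0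
  have i1 := congrArg D h1
  have i1' := congrArg D h1'
  have i1₀ := congrArg D h1₀
  simp only [map_add, map_neg, map_smul, map_zero, add_zero, zero_add] at i1 i1' i1₀ h2 h2' h2₀
  refine ⟨(1 / 6) * ((ν - μ) + (ν' - μ') - 2 * (ν₀ - μ₀)), ?_⟩
  linear_combination (norm := module)
    (1 / 6 : ℝ) • (h2 - i1 + (h2' - i1') - (2 : ℝ) • (h2₀ - i1₀))

/-- If `D a` is not a multiple of `D u`, its coefficient has to vanish, and if `a = r u`, both
quotients are equal to `r`. -/
theorem coeff_eq_of_quadratic_part {D : E →L[ℝ] E} (hD : Function.Injective D) {u a : E}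
    {γ₁ γ₂ : E →L[ℝ] ℝ} {c : ℝ} (h₁ : γ₁ u ≠ 0) (h₂ : γ₂ (D u) ≠ 0)
    (h : (γ₁ a / γ₁ u - γ₂ (D a) / γ₂ (D u)) • D a = c • D u) :
    γ₁ a / γ₁ u = γ₂ (D a) / γ₂ (D u) := by
  by_contra hne
  have hne' := sub_ne_zero.2 hne
  have ha : a = ((γ₁ a / γ₁ u - γ₂ (D a) / γ₂ (D u))⁻¹ * c) • u := by
    apply hD
    rw [map_smul, mul_smul, ← h, inv_smul_smul₀ hne']
  generalize (γ₁ a / γ₁ u - γ₂ (D a) / γ₂ (D u))⁻¹ * c = r at ha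
  subst ha
  apply hne
  simp only [map_smul, smul_eq_mul]
  field_simp

variable [CompleteSpace E]

theorem differentiableAt_covAccel {G : E → E →L[ℝ] E →L[ℝ] ℝ} {U : Set E} (hG : IsMetricOn G U)
    {x : ℝ → E} {t : ℝ} (hx : ContDiffAt ℝ 3 x t) (hxt : x t ∈ U) :
    DifferentiableAt ℝ (covAccel G x) t := by
  have hx2 := hx.of_le two_le_three_smooth
  have h1 := ((hG.differentiableAt_christoffelL hxt).hasFDerivAt.comp_hasDerivAt t
    (hasDerivAt_of_contDiffAt_two hx2)).clm_apply (hasDerivAt_deriv hx2)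
  exact ((hasDerivAt_deriv_deriv hx).add (h1.clm_apply (hasDerivAt_deriv hx2))).differentiableAt

/-- For curves `x` through `y` with velocity `u`, the covariant acceleration of `F ∘ x` and its
covariant derivative are affine functions of the second and third derivatives of `x`. -/
theorem affine_thirdOrder_comp {G : E → E →L[ℝ] E →L[ℝ] ℝ} {U : Set E} (hG : IsMetricOn G U)
    {V : Set E} {F : E → E} (hV : IsOpen V) (hF : ContDiffOn ℝ ∞ F V) (hFV : MapsTo F V U) {y : E}
    (hy : y ∈ V) (u : E) :
    ∃ (e : E) (L : E →L[ℝ] E) (k : E), ∀ (x : ℝ → E) (t : ℝ), ContDiffAt ℝ 3 x t → x t = y →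
      deriv x t = u →
      covAccel G (fun s => F (x s)) t = fderiv ℝ F y (deriv (deriv x) t) + e ∧
      deriv (covAccel G (fun s => F (x s))) t + christoffelL G (F y) (fderiv ℝ F y u)
        (covAccel G (fun s => F (x s)) t) =
          fderiv ℝ F y (deriv (deriv (deriv x)) t) + L (deriv (deriv x) t) + k := by
  let Φ : E × E → E := fun p => fderiv ℝ (fderiv ℝ F) p.1 p.2 p.2
    + christoffelL G (F p.1) (fderiv ℝ F p.1 p.2) (fderiv ℝ F p.1 p.2)
  have hF' := hF.fderiv_of_isOpen (m := ∞) hV (by simp)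
  have hF'' := hF'.fderiv_of_isOpen (m := ∞) hV (by simp)
  have hd0 := (hF.contDiffAt (hV.mem_nhds hy)).differentiableAt (by simp)
  have hd1 := (hF'.contDiffAt (hV.mem_nhds hy)).differentiableAt (by simp)
  have hd2 := (hF''.contDiffAt (hV.mem_nhds hy)).differentiableAt (by simp)
  have hΓ := hG.differentiableAt_christoffelL (hFV hy)
  have hΦ : DifferentiableAt ℝ Φ (y, u) := by
    have hfst : DifferentiableAt ℝ (Prod.fst : E × E → E) (y, u) := differentiableAt_fst
    have hsnd : DifferentiableAt ℝ (Prod.snd : E × E → E) (y, u) := differentiableAt_snd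
    have a0 : DifferentiableAt ℝ (fun p : E × E => F p.1) (y, u) :=
      DifferentiableAt.comp (g := F) (y, u) hd0 hfst
    have a1 : DifferentiableAt ℝ (fun p : E × E => fderiv ℝ F p.1) (y, u) :=
      DifferentiableAt.comp (g := fderiv ℝ F) (y, u) hd1 hfst
    have a2 : DifferentiableAt ℝ (fun p : E × E => fderiv ℝ (fderiv ℝ F) p.1) (y, u) :=
      DifferentiableAt.comp (g := fderiv ℝ (fderiv ℝ F)) (y, u) hd2 hfst
    have a3 : DifferentiableAt ℝ (fun p : E × E => christoffelL G (F p.1)) (y, u) :=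
      DifferentiableAt.comp (g := christoffelL G) (f := fun p : E × E => F p.1) (y, u) hΓ a0
    have a4 := a1.clm_apply hsnd
    exact ((a2.clm_apply hsnd).clm_apply hsnd).add ((a3.clm_apply a4).clm_apply a4)
  refine ⟨Φ (y, u), fderiv ℝ (fderiv ℝ F) y u
      + (fderiv ℝ Φ (y, u)).comp (ContinuousLinearMap.inr ℝ E E)
      + (christoffelL G (F y) (fderiv ℝ F y u)).comp (fderiv ℝ F y),
    fderiv ℝ Φ (y, u) (u, 0) + christoffelL G (F y) (fderiv ℝ F y u) (Φ (y, u)),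
    fun x t hx hxt hxu => ?_⟩
  have hx2 := hx.of_le two_le_three_smooth
  have hA : covAccel G (fun s => F (x s)) =ᶠ[𝓝 t] fun s =>
      fderiv ℝ F (x s) (deriv (deriv x) s) + Φ (x s, deriv x s) := by
    have hmem : ∀ᶠ s in 𝓝 t, x s ∈ V :=
      hx.continuousAt.eventually (hV.mem_nhds (hxt ▸ hy))
    filter_upwards [hmem, hx2.eventually (by simp)] with s hs hxs
    obtain ⟨h1, h2⟩ := deriv_deriv_comp
      ((hF.contDiffAt (hV.mem_nhds hs)).of_le ENat.LEInfty.out) hxs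
    rw [covAccel, h2, h1.self_of_nhds]
    simp only [Φ]
    abel
  have hx1 := hasDerivAt_of_contDiffAt_two hx2
  have hx1' := hasDerivAt_deriv hx2
  have hA0 := hA.self_of_nhds
  rw [← hxt] at hd1
  rw [← hxt, ← hxu] at hΦ
  have hd := (((hd1.hasFDerivAt.comp_hasDerivAt t hx1).clm_apply (hasDerivAt_deriv_deriv hx)).add
    (hΦ.hasFDerivAt.comp_hasDerivAt t (hx1.prodMk hx1'))).congr_of_eventuallyEq hA
  subst hxt hxu
  refine ⟨hA0, ?_⟩
  rw [hd.deriv, hA0]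
  have hsplit : (deriv x t, deriv (deriv x) t) = (deriv x t, 0) + (0, deriv (deriv x) t) := by simp
  rw [hsplit, map_add]
  simp
  abel

variable [FiniteDimensional ℝ E]

/-- The third-order equation of unparametrized conformal circles: with `u` the velocity and
`a = ∇_u u` the acceleration, `∇_u a` equals `3 g(u, a) / g(u, u) a + g(u, u) P♯ u` modulo
multiples of `u`. -/
def ThirdOrder (G : E → E →L[ℝ] E →L[ℝ] ℝ) (x : ℝ → E) (t : ℝ) : Prop :=
  ∃ μ : ℝ, deriv (covAccel G x) t + christoffelL G (x t) (deriv x t) (covAccel G x t) =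
    (3 * G (x t) (deriv x t) (covAccel G x t) / G (x t) (deriv x t) (deriv x t)) • covAccel G x t
    + G (x t) (deriv x t) (deriv x t) •
      sharpL G (x t) (LinearMap.toContinuousLinearMap (schoutenL G (x t) (deriv x t)))
    + μ • deriv x t

variable {G : E → E →L[ℝ] E →L[ℝ] ℝ} {U : Set E} {x : ℝ → E} {t : ℝ}

/-- The `1`-form `β` is eliminated by `g(u, u) β♯ = ∇_u u + 2 β(u) u`. -/
theorem ThirdOrder.of_circle (hG : IsMetricOn G U) (hx : ContDiffAt ℝ 3 x t) (hxt : x t ∈ U)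
    {β : ℝ → E →L[ℝ] ℝ} (hc : ∀ᶠ s in 𝓝 t, CircleSystemL G x β s)
    (hg : G (x t) (deriv x t) (deriv x t) ≠ 0) : ThirdOrder G x t := by
  have hinv := hG.inv _ hxt
  have hx2 := hx.of_le two_le_three_smooth
  have hx1 := hasDerivAt_of_contDiffAt_two hx2
  have hx' := hasDerivAt_deriv hx2
  have hβ := hc.self_of_nhds.form
  have hA : covAccel G x =ᶠ[𝓝 t] fun s => -((2 * β s (deriv x s)) • deriv x s
      - G (x s) (deriv x s) (deriv x s) • sharpL G (x s) (β s)) := by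
    filter_upwards [hc] with s hs using hs.accel
  have hGx := (hG.differentiableAt hxt).hasFDerivAt.comp_hasDerivAt t hx1
  have hS : HasDerivAt (fun s => sharpL G (x s) (β s))
      (sharpL G (x t) (formRate G (x t) (deriv x t) (β t)
        - (β t).comp (christoffelL G (x t) (deriv x t)))
        - christoffelL G (x t) (deriv x t) (sharpL G (x t) (β t))) t := by
    have hd : DifferentiableAt ℝ (sharpL G) (x t) :=
      (hG.smooth_sharpL.contDiffAt (hG.isOpen.mem_nhds hxt)).differentiableAt (by simp)
    have hs : DifferentiableAt ℝ (fun s => sharpL G (x s) (β s)) t :=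
      ((hd.hasFDerivAt.comp_hasDerivAt t hx1).clm_apply hβ).differentiableAt
    refine hs.hasDerivAt.congr_deriv ?_
    rw [eq_sub_iff_add_eq]
    refine eq_sharpL hinv fun w => ?_
    have hev : (fun s => G (x s) (sharpL G (x s) (β s)) w) =ᶠ[𝓝 t] fun s => β s w := by
      filter_upwards [hx.continuousAt.eventually (hG.isOpen.mem_nhds hxt)] with s hs
      rw [apply_sharpL (hG.inv _ hs)]
    have h1 := (hGx.clm_apply hs.hasDerivAt).clm_apply (hasDerivAt_const t w)
    have h2 := hβ.clm_apply (hasDerivAt_const t w)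
    have h3 := h1.unique (h2.congr_of_eventuallyEq hev)
    simp only [hG.fderiv_form hxt, apply_sharpL hinv, map_zero, add_zero, add_apply,
      Function.comp_apply] at h3
    simp only [map_add, add_apply, sub_apply, ContinuousLinearMap.comp_apply]
    linarith
  have hc1 := (hβ.clm_apply hx').const_mul (2 : ℝ)
  have hgd := (hGx.clm_apply hx').clm_apply hx'
  have hd := (((hc1.smul hx').sub (hgd.smul hS)).neg.congr_of_eventuallyEq hA).deriv
  have hA0 := hA.self_of_nhds
  have hx'' : deriv (deriv x) t
      = covAccel G x t - christoffelL G (x t) (deriv x t) (deriv x t) := by simp [covAccel]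
  have hFR : sharpL G (x t) (formRate G (x t) (deriv x t) (β t)
        - (β t).comp (christoffelL G (x t) (deriv x t))) =
      β t (deriv x t) • sharpL G (x t) (β t)
        - (1 / 2 * β t (sharpL G (x t) (β t))) • deriv x t
        + sharpL G (x t) (LinearMap.toContinuousLinearMap (schoutenL G (x t) (deriv x t))) := by
    rw [formRate, add_sub_cancel_left, map_add, map_sub, map_smul, map_smul, sharpL_apply hinv]
  set c' := 2 * (formRate G (x t) (deriv x t) (β t) (deriv x t) + β t (deriv (deriv x) t)) with hc'
  set A := covAccel G x t with hAdef
  set u := deriv x t with hu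
  set g := G (x t) u u with hgdef
  have hs : G (x t) u (sharpL G (x t) (β t)) = β t u := by
    rw [hG.symm _ hxt, apply_sharpL hinv]
  have hGA : G (x t) u A = -(β t u * g) := by
    rw [hA0]
    simp only [map_neg, map_sub, map_smul, hs, smul_eq_mul]
    rw [← hgdef]
    ring
  have hg' : (fderiv ℝ G (x t) u u + G (x t) (deriv (deriv x) t)) u + G (x t) u (deriv (deriv x) t)
      = 2 * G (x t) u A := by
    rw [hx'', add_apply, hG.fderiv_form hxt]
    simp only [map_sub, sub_apply]
    rw [hG.symm _ hxt _ u, hG.symm _ hxt A u]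
    ring
  have hg3 : 3 * G (x t) u A / g = -3 * β t u := by
    rw [hGA]
    field_simp
  have hgs : g • sharpL G (x t) (β t) = A + (2 * β t u) • u := by
    rw [hA0]
    module
  refine ⟨-c' - 2 * (β t u) ^ 2 - g * (1 / 2 * β t (sharpL G (x t) (β t))), ?_⟩
  rw [hg3, hd, hFR]
  simp only [Function.comp_apply]
  have hΓA : christoffelL G (x t) u A = -((2 * β t u) • christoffelL G (x t) u u
      - g • christoffelL G (x t) u (sharpL G (x t) (β t))) := by
    rw [hA0]
    simp only [map_neg, map_sub, map_smul]
    rfl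
  rw [hg', hGA, ← hAdef, ← hu, ← hgdef, hx'']
  linear_combination (norm := module) hΓA - β t u • hgs

/-- The third-order equation is invariant under regular changes of parameter. -/
theorem ThirdOrder.of_comp (hG : IsMetricOn G U) {φ : ℝ → ℝ} {s : ℝ}
    (hφ : ContDiffAt ℝ 3 φ s) (hφ' : deriv φ s ≠ 0) (hx : ContDiffAt ℝ 3 x (φ s))
    (hxt : x (φ s) ∈ U) (hg : G (x (φ s)) (deriv x (φ s)) (deriv x (φ s)) ≠ 0)
    (h : ThirdOrder G (fun r => x (φ r)) s) : ThirdOrder G x (φ s) := by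
  have hφ2 := hφ.of_le two_le_three_smooth
  have hx2 := hx.of_le two_le_three_smooth
  have e1 : deriv (fun r => x (φ r)) =ᶠ[𝓝 s] fun r => deriv φ r • deriv x (φ r) := by
    filter_upwards [eventually_hasDerivAt hφ2,
      hφ.continuousAt.eventually (eventually_hasDerivAt hx2)] with r h1 h2
    exact (h2.scomp r h1).deriv
  have e2 : deriv (deriv fun r => x (φ r)) =ᶠ[𝓝 s] fun r =>
      deriv φ r ^ 2 • deriv (deriv x) (φ r) + deriv (deriv φ) r • deriv x (φ r) := by
    filter_upwards [eventually_eventuallyEq_nhds.2 e1, hφ2.eventually (by simp),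
      hφ.continuousAt.eventually (hx2.eventually (by simp))] with r h0 h1 h2
    rw [h0.deriv_eq]
    have h3 := (hasDerivAt_deriv h1).smul
      ((hasDerivAt_deriv h2).scomp r (hasDerivAt_of_contDiffAt_two h1))
    refine h3.deriv.trans ?_
    simp only [Function.comp_apply]
    module
  have hA : covAccel G (fun r => x (φ r)) =ᶠ[𝓝 s] fun r =>
      deriv φ r ^ 2 • covAccel G x (φ r) + deriv (deriv φ) r • deriv x (φ r) := by
    filter_upwards [e1, e2] with r h1 h2
    rw [covAccel, covAccel, h1, h2]
    simp only [map_smul, smul_apply]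
    module
  have hφd := hasDerivAt_of_contDiffAt_two hφ2
  have hAd := (differentiableAt_covAccel hG hx hxt).hasDerivAt.scomp s hφd
  have hxd := (hasDerivAt_deriv hx2).scomp s hφd
  have hd := ((((hasDerivAt_deriv hφ2).pow 2).smul hAd).add
    ((hasDerivAt_deriv_deriv hφ).smul hxd))
  have hd := (hd.congr_of_eventuallyEq hA).deriv
  obtain ⟨μ, hμ⟩ := h
  simp only [hA.self_of_nhds, e1.self_of_nhds, hd] at hμ
  have hx'' : deriv (deriv x) (φ s) = covAccel G x (φ s)
      - christoffelL G (x (φ s)) (deriv x (φ s)) (deriv x (φ s)) := by simp [covAccel]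
  simp only [Function.comp_apply, Pi.pow_apply, hx'', map_add, map_smul, smul_apply,
    smul_eq_mul] at hμ
  rw [ThirdOrder]
  generalize covAccel G x (φ s) = A at *
  generalize deriv (covAccel G x) (φ s) = A' at *
  generalize deriv x (φ s) = u at *
  generalize deriv φ s = p at *
  obtain ⟨q, hq⟩ : ∃ q, deriv (deriv φ) s = p * q := ⟨deriv (deriv φ) s / p, by field_simp⟩
  have hcoef : 3 * (p ^ 2 * (p * G (x (φ s)) u A) + p * q * (p * G (x (φ s)) u u))
      / (p * (p * G (x (φ s)) u u)) = p * (3 * G (x (φ s)) u A / G (x (φ s)) u u) + 3 * q := by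
    field_simp
  rw [hq, hcoef] at hμ
  obtain ⟨m, hm⟩ : ∃ m, p ^ 3 * m = μ * p + p * q *
      (p * (3 * G (x (φ s)) u A / G (x (φ s)) u u) + 3 * q) - deriv (deriv (deriv φ)) s :=
    ⟨_ / p ^ 3, mul_div_cancel₀ _ (pow_ne_zero 3 hφ')⟩
  refine ⟨m, smul_right_injective E (pow_ne_zero 3 hφ') ?_⟩
  simp only
  push_cast at hμ
  linear_combination (norm := module) hμ - hm • u

/-- If the map `F` takes sufficiently many solutions of the third-order equation of `G` through a
point to solutions of the equation of `H`, then it preserves orthogonality there. -/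
theorem form_div_eq_of_thirdOrder {H : E → E →L[ℝ] E →L[ℝ] ℝ} {V : Set E} {F : E → E} {y u : E}
    (hG : IsMetricOn G U) (hH : IsMetricOn H V) (hF : ContDiffOn ℝ ∞ F U) (hFV : MapsTo F U V)
    (hy : y ∈ U) (hinj : Function.Injective (fderiv ℝ F y)) (hg : G y u u ≠ 0)
    (hh : H (F y) (fderiv ℝ F y u) (fderiv ℝ F y u) ≠ 0)
    (hc : ∀ a, ∃ (x : ℝ → E) (t : ℝ), ContDiffAt ℝ 3 x t ∧ x t = y ∧ deriv x t = u ∧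
      deriv (deriv x) t = a ∧ ThirdOrder G x t ∧ ThirdOrder H (fun s => F (x s)) t) (a : E) :
    G y u a / G y u u = H (F y) (fderiv ℝ F y u) (fderiv ℝ F y a)
      / H (F y) (fderiv ℝ F y u) (fderiv ℝ F y u) := by
  obtain ⟨e₁, L₁, k₁, h₁⟩ :=
    affine_thirdOrder_comp hG hG.isOpen contDiffOn_id (mapsTo_id U) hy u
  obtain ⟨e₂, L₂, k₂, h₂⟩ := affine_thirdOrder_comp hH hG.isOpen hF hFV hy u
  have key := quadratic_part_eq (D := fderiv ℝ F y) (L₁ := L₁) (L₂ := L₂)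
    (k₁ := k₁ - G y u u • sharpL G y (LinearMap.toContinuousLinearMap (schoutenL G y u)))
    (k₂ := k₂ - H (F y) (fderiv ℝ F y u) (fderiv ℝ F y u) • sharpL H (F y)
      (LinearMap.toContinuousLinearMap (schoutenL H (F y) (fderiv ℝ F y u))))
    (e₁ := e₁) (e₂ := e₂) (u := u) (γ₁ := G y u) (γ₂ := H (F y) (fderiv ℝ F y u))
    (g₁ := G y u u) (g₂ := H (F y) (fderiv ℝ F y u) (fderiv ℝ F y u)) ?_ a
  · obtain ⟨c, hc⟩ := key
    exact coeff_eq_of_quadratic_part hinj hg hh hc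
  · intro a
    obtain ⟨x, t, hx, hxt, hxu, hxa, ⟨μ, hμ⟩, ν, hν⟩ := hc a
    obtain ⟨h1, h1'⟩ := h₁ x t hx hxt hxu
    obtain ⟨h2, h2'⟩ := h₂ x t hx hxt hxu
    have hF2 : ContDiffAt ℝ 2 F (x t) :=
      (hF.contDiffAt (hG.isOpen.mem_nhds (hxt ▸ hy))).of_le ENat.LEInfty.out
    have hd := (deriv_deriv_comp hF2 (hx.of_le two_le_three_smooth)).1.self_of_nhds
    simp only [id_eq, fderiv_id, ContinuousLinearMap.id_apply, hxa] at h1 h1'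
    rw [hxt, hxu, h1', h1] at hμ
    simp only [hd] at hν
    rw [hxt, hxu, h2', h2, hxa] at hν
    refine ⟨deriv (deriv (deriv x)) t, μ, ν, ?_, ?_⟩
    · rw [← add_sub_assoc, hμ]
      abel
    · rw [← add_sub_assoc, hν]
      abel

end

/-! ### Existence of conformal circles -/

section

/-- Solutions of a smooth autonomous differential equation are smooth. -/
theorem contDiffOn_of_hasDerivAt {X : Type*} [NormedAddCommGroup X] [NormedSpace ℝ X] {V : X → X}
    {Ω : Set X} (hV : ContDiffOn ℝ ∞ V Ω) {α : ℝ → X} {I : Set ℝ} (hI : IsOpen I)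
    (hα : ∀ t ∈ I, HasDerivAt α (V (α t)) t) (hmem : MapsTo α I Ω) : ContDiffOn ℝ ∞ α I := by
  have hdiff : DifferentiableOn ℝ α I := fun t ht =>
    (hα t ht).differentiableAt.differentiableWithinAt
  rw [contDiffOn_infty]
  intro k
  induction k with
  | zero => simpa using hdiff.continuousOn
  | succ k ih =>
    rw [Nat.cast_add, Nat.cast_one, contDiffOn_succ_iff_deriv_of_isOpen hI]
    refine ⟨hdiff, by simp, ?_⟩
    have h1 : ContDiffOn ℝ k (fun t => V (α t)) I :=
      (hV.of_le (by exact_mod_cast le_top)).comp ih hmem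
    exact h1.congr fun t ht => (hα t ht).deriv

variable {E : Type*} [NormedAddCommGroup E] [NormedSpace ℝ E]

theorem IsMetricOn.smooth_curvatureL [CompleteSpace E] {G : E → E →L[ℝ] E →L[ℝ] ℝ} {U : Set E}
    (hG : IsMetricOn G U) (u v w : E) :
    ContDiffOn ℝ ∞ (fun y => curvatureL G y u v w) U := by
  have h := hG.smooth_christoffelL
  have h' := h.fderiv_of_isOpen (m := ∞) hG.isOpen (by simp)
  have c (a : E) : ContDiffOn ℝ ∞ (fun _ : E => a) U := contDiffOn_const
  have hab (a b : E) : ContDiffOn ℝ ∞ (fun y => christoffelL G y a b) U :=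
    (h.clm_apply (c a)).clm_apply (c b)
  exact (((((h'.clm_apply (c u)).clm_apply (c v)).clm_apply (c w)).sub
    (((h'.clm_apply (c v)).clm_apply (c u)).clm_apply (c w))).add
    ((h.clm_apply (c u)).clm_apply (hab v w))).sub ((h.clm_apply (c v)).clm_apply (hab u w))

variable [FiniteDimensional ℝ E]

theorem contDiffOn_toContinuousLinearMap {f : E → E →ₗ[ℝ] ℝ} {U : Set E}
    (h : ∀ v, ContDiffOn ℝ ∞ (fun y => f y v) U) :
    ContDiffOn ℝ ∞ (fun y => LinearMap.toContinuousLinearMap (f y)) U :=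
  contDiffOn_clm_apply.2 h

theorem contDiffOn_trace {U : Set E} {A : E → E →ₗ[ℝ] E}
    (hA : ∀ v, ContDiffOn ℝ ∞ (fun y => A y v) U) :
    ContDiffOn ℝ ∞ (fun y => LinearMap.trace ℝ E (A y)) U := by
  let b := Module.finBasis ℝ E
  have h (y : E) : LinearMap.trace ℝ E (A y)
      = ∑ i, LinearMap.toContinuousLinearMap (b.coord i) (A y (b i)) := by
    rw [LinearMap.trace_eq_matrix_trace ℝ b, Matrix.trace]
    simp [LinearMap.toMatrix_apply]
  simp only [h]
  exact ContDiffOn.sum fun i _ => contDiffOn_const.clm_apply (hA (b i))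

/-- The vector field on positions, velocities and `1`-forms whose integral curves are the
solutions of the conformal circle system. -/
noncomputable def circleField (G : E → E →L[ℝ] E →L[ℝ] ℝ) (p : E × E × (E →L[ℝ] ℝ)) :
    E × E × (E →L[ℝ] ℝ) :=
  (p.2.1, -((2 * p.2.2 p.2.1) • p.2.1 - G p.1 p.2.1 p.2.1 • sharpL G p.1 p.2.2)
    - christoffelL G p.1 p.2.1 p.2.1, formRate G p.1 p.2.1 p.2.2)

variable [CompleteSpace E]

namespace IsMetricOn

variable {G : E → E →L[ℝ] E →L[ℝ] ℝ} {U : Set E}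

theorem smooth_ricciL (hG : IsMetricOn G U) (v w : E) :
    ContDiffOn ℝ ∞ (fun y => ricciL G y v w) U :=
  contDiffOn_trace fun u => hG.smooth_curvatureL u v w

theorem smooth_scalarL (hG : IsMetricOn G U) : ContDiffOn ℝ ∞ (scalarL G) U :=
  contDiffOn_trace fun u => hG.smooth_sharpL.clm_apply
    (contDiffOn_toContinuousLinearMap fun w => hG.smooth_ricciL u w)

theorem smooth_schoutenL (hG : IsMetricOn G U) (v w : E) :
    ContDiffOn ℝ ∞ (fun y => schoutenL G y v w) U := by
  simp only [schoutenL_apply]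
  exact contDiffOn_const.mul ((hG.smooth_ricciL v w).sub ((hG.smooth_scalarL.div_const _).mul
    ((hG.smooth.clm_apply contDiffOn_const).clm_apply contDiffOn_const)))

theorem smooth_circleField (hG : IsMetricOn G U) :
    ContDiffOn ℝ ∞ (circleField G) (Prod.fst ⁻¹' U) := by
  have hy : ContDiffOn ℝ ∞ (fun p : E × E × (E →L[ℝ] ℝ) => p.1) (Prod.fst ⁻¹' U) :=
    contDiffOn_fst
  have hu : ContDiffOn ℝ ∞ (fun p : E × E × (E →L[ℝ] ℝ) => p.2.1) (Prod.fst ⁻¹' U) :=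
    (contDiff_fst.comp contDiff_snd).contDiffOn
  have hβ : ContDiffOn ℝ ∞ (fun p : E × E × (E →L[ℝ] ℝ) => p.2.2) (Prod.fst ⁻¹' U) :=
    (contDiff_snd.comp contDiff_snd).contDiffOn
  have hm : MapsTo (fun p : E × E × (E →L[ℝ] ℝ) => p.1) (Prod.fst ⁻¹' U) U := fun _ h => h
  have hGp := (hG.smooth.comp hy hm).clm_apply hu
  have hΓ := (hG.smooth_christoffelL.comp hy hm).clm_apply hu
  have hs := (hG.smooth_sharpL.comp hy hm).clm_apply hβ
  have hP : ContDiffOn ℝ ∞ (fun p : E × E × (E →L[ℝ] ℝ) =>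
      LinearMap.toContinuousLinearMap (schoutenL G p.1 p.2.1)) (Prod.fst ⁻¹' U) := by
    have h1 : ContDiffOn ℝ ∞ (fun y => LinearMap.toContinuousLinearMap
        ((LinearMap.toContinuousLinearMap (𝕜 := ℝ) (E := E) (F' := ℝ)).toLinearMap ∘ₗ
          schoutenL G y)) U :=
      contDiffOn_clm_apply.2 fun v => contDiffOn_clm_apply.2 fun w => hG.smooth_schoutenL v w
    exact (h1.comp hy hm).clm_apply hu
  refine hu.prodMk (ContDiffOn.prodMk (((contDiffOn_const.mul (hβ.clm_apply hu)).smul hu |>.sub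
    ((hGp.clm_apply hu).smul hs)).neg.sub (hΓ.clm_apply hu)) ?_)
  exact (hβ.clm_comp hΓ).add ((((hβ.clm_apply hu).smul hβ).sub
    ((contDiffOn_const.mul (hβ.clm_apply hs)).smul hGp)).add hP)

/-- Short-time existence for the conformal circle system. -/
theorem exists_circleSystemL (hG : IsMetricOn G U) {y u : E} (hy : y ∈ U) (hu : u ≠ 0)
    (β₀ : E →L[ℝ] ℝ) : ∃ ε > 0, ∃ (x : ℝ → E) (β : ℝ → E →L[ℝ] ℝ),
      ContDiffOn ℝ ∞ x (Ioo (-ε) ε) ∧ x 0 = y ∧ deriv x 0 = u ∧ β 0 = β₀ ∧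
      ∀ t ∈ Ioo (-ε) ε, x t ∈ U ∧ deriv x t ≠ 0 ∧ CircleSystemL G x β t := by
  have hV := hG.smooth_circleField
  have hopen : IsOpen ((Prod.fst : E × E × (E →L[ℝ] ℝ) → E) ⁻¹' U) :=
    hG.isOpen.preimage continuous_fst
  have hat : ContDiffAt ℝ 1 (circleField G) (y, u, β₀) :=
    (hV.contDiffAt (hopen.mem_nhds hy)).of_le ENat.LEInfty.out
  obtain ⟨α, hα0, ε, hε, hα⟩ :=
    hat.exists_forall_mem_closedBall_exists_eq_forall_mem_Ioo_hasDerivAt₀ 0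
  simp only [zero_sub, zero_add] at hα
  have hε0 : (0 : ℝ) ∈ Ioo (-ε) ε := ⟨by linarith, hε⟩
  have hcont := (hα 0 hε0).continuousAt
  have hΩ : ∀ᶠ t in 𝓝 (0 : ℝ), (α t).1 ∈ U ∧ (α t).2.1 ≠ 0 := by
    refine (hcont.eventually (hopen.mem_nhds (by rw [hα0]; exact hy))).and ?_
    have h2 : ContinuousAt (fun t => (α t).2.1) 0 := hcont.snd.fst
    exact h2.eventually_ne (by rwa [hα0])
  obtain ⟨δ, hδ, hδ'⟩ := Metric.eventually_nhds_iff_ball.1 hΩ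
  rw [Real.ball_eq_Ioo] at hδ'
  simp only [zero_sub, zero_add] at hδ'
  -- Restrict to times at which the curve has not left `U` and is still regular.
  set r := min ε δ
  have hr : 0 < r := lt_min hε hδ
  have hsub1 : Ioo (-r) r ⊆ Ioo (-ε) ε :=
    Ioo_subset_Ioo (neg_le_neg (min_le_left _ _)) (min_le_left _ _)
  have hsub2 : Ioo (-r) r ⊆ Ioo (-δ) δ :=
    Ioo_subset_Ioo (neg_le_neg (min_le_right _ _)) (min_le_right _ _)
  have hsm : ContDiffOn ℝ ∞ α (Ioo (-r) r) := contDiffOn_of_hasDerivAt hV isOpen_Ioo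
    (fun t ht => hα t (hsub1 ht)) fun t ht => (hδ' t (hsub2 ht)).1
  have hx (t : ℝ) (ht : t ∈ Ioo (-r) r) : HasDerivAt (fun t => (α t).1) (α t).2.1 t :=
    (ContinuousLinearMap.fst ℝ E (E × (E →L[ℝ] ℝ))).hasFDerivAt.comp_hasDerivAt t (hα t (hsub1 ht))
  have h0 : (0 : ℝ) ∈ Ioo (-r) r := ⟨by linarith, hr⟩
  refine ⟨r, hr, fun t => (α t).1, fun t => (α t).2.2, contDiff_fst.comp_contDiffOn hsm,
    by simp [hα0], by rw [(hx 0 h0).deriv, hα0], by simp [hα0], fun t ht => ?_⟩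
  have hd := (hx t ht).deriv
  have hdd : deriv (fun t => (α t).1) =ᶠ[𝓝 t] fun t => (α t).2.1 := by
    filter_upwards [isOpen_Ioo.mem_nhds ht] with s hs using (hx s hs).deriv
  have h2 := (ContinuousLinearMap.snd ℝ E (E × (E →L[ℝ] ℝ))).hasFDerivAt.comp_hasDerivAt t
    (hα t (hsub1 ht))
  have hu' : HasDerivAt (fun t => (α t).2.1) (circleField G (α t)).2.1 t :=
    (ContinuousLinearMap.fst ℝ E (E →L[ℝ] ℝ)).hasFDerivAt.comp_hasDerivAt t h2
  have hβ' : HasDerivAt (fun t => (α t).2.2) (circleField G (α t)).2.2 t :=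
    (ContinuousLinearMap.snd ℝ E (E →L[ℝ] ℝ)).hasFDerivAt.comp_hasDerivAt t h2
  refine ⟨(hδ' t (hsub2 ht)).1, by rw [hd]; exact (hδ' t (hsub2 ht)).2, ?_, ?_⟩
  · rw [covAccel, hdd.deriv_eq, hu'.deriv, hd]
    simp [circleField]
  · rw [hd]
    exact hβ'

/-- There is a conformal circle with any given non-null initial velocity and any given initial
second derivative. -/
theorem exists_circleSystemL_of_accel (hG : IsMetricOn G U) {y u : E} (hy : y ∈ U)
    (hg : G y u u ≠ 0) (a : E) : ∃ ε > 0, ∃ (x : ℝ → E) (β : ℝ → E →L[ℝ] ℝ),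
      ContDiffOn ℝ ∞ x (Ioo (-ε) ε) ∧ x 0 = y ∧ deriv x 0 = u ∧ deriv (deriv x) 0 = a ∧
      ∀ t ∈ Ioo (-ε) ε, x t ∈ U ∧ deriv x t ≠ 0 ∧ CircleSystemL G x β t := by
  have hu : u ≠ 0 := by
    rintro rfl
    simp at hg
  -- The `1`-form is found by solving `A = -2 β(u) u + g(u, u) β♯` for `β`.
  set A := a + christoffelL G y u u with hA
  obtain ⟨ε, hε, x, β, hx, hx0, hx0', hβ0, h⟩ := hG.exists_circleSystemL hy hu
    ((G y u u)⁻¹ • G y (A - (2 * G y u A / G y u u) • u))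
  refine ⟨ε, hε, x, β, hx, hx0, hx0', ?_, h⟩
  have h1 := (h 0 ⟨by linarith, hε⟩).2.2.accel
  rw [covAccel, hx0, hx0', hβ0, ← eq_sub_iff_add_eq] at h1
  rw [h1]
  simp only [map_smul, map_sub, sharpL_apply (hG.inv y hy), smul_apply, sub_apply,
    hG.symm y hy A u, smul_eq_mul]
  rw [smul_inv_smul₀ hg]
  have hc : 2 * ((G y u u)⁻¹ * (G y u A - 2 * G y u A / G y u u * G y u u))
      = -(2 * G y u A / G y u u) := by
    field_simp
    ring
  rw [hc, hA]
  module

end IsMetricOn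

end

/-! ### Maps and metrics in charts -/

section

variable {n p q : ℕ} {M : Type*} [TopologicalSpace M] [ChartedSpace (Coord n) M]
  {N : Type*} [TopologicalSpace N] [ChartedSpace (Coord n) N]

section LocalRepresentative

variable (f : M → N) (x₀ : M) (y₀ : N)

/-- The map `f` in the charts around `x₀` and `y₀`, meaningful on `localDom f x₀ y₀`. -/
noncomputable def localRep (y : Coord n) : Coord n :=
  extChartAt (𝓡 n) y₀ (f ((extChartAt (𝓡 n) x₀).symm y))

/-- The domain of the expression of `f` in the charts around `x₀` and `y₀`. -/
def localDom : Set (Coord n) :=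
  (extChartAt (𝓡 n) x₀).target ∩
    (extChartAt (𝓡 n) x₀).symm ⁻¹' (f ⁻¹' (extChartAt (𝓡 n) y₀).source)

variable {f x₀ y₀}

theorem mem_localDom {x : M} (hx : x ∈ (extChartAt (𝓡 n) x₀).source)
    (hy : f x ∈ (extChartAt (𝓡 n) y₀).source) : extChartAt (𝓡 n) x₀ x ∈ localDom f x₀ y₀ := by
  refine ⟨(extChartAt (𝓡 n) x₀).map_source hx, ?_⟩
  rw [mem_preimage, (extChartAt (𝓡 n) x₀).left_inv hx]
  exact hy

theorem isOpen_localDom (hf : Continuous f) : IsOpen (localDom (n := n) f x₀ y₀) :=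
  (continuousOn_extChartAt_symm x₀).isOpen_inter_preimage (isOpen_extChartAt_target x₀)
    ((isOpen_extChartAt_source y₀).preimage hf)

theorem mapsTo_localRep :
    MapsTo (localRep (n := n) f x₀ y₀) (localDom f x₀ y₀) (extChartAt (𝓡 n) y₀).target :=
  fun _ hy => (extChartAt (𝓡 n) y₀).map_source hy.2

end LocalRepresentative

variable [IsManifold (𝓡 n) ∞ M] [IsManifold (𝓡 n) ∞ N]

section Frame

variable {x₀ x : M}

theorem coordFrame_mfderiv (hx : x ∈ (extChartAt (𝓡 n) x₀).source) (v : TangentSpace (𝓡 n) x) :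
    coordFrame x₀ x (mfderiv (𝓡 n) 𝓘(ℝ, Coord n) (extChartAt (𝓡 n) x₀) x v) = v := by
  rw [extChartAt_source] at hx
  rw [coordFrame, ← TangentBundle.continuousLinearMapAt_trivializationAt hx]
  exact Bundle.Trivialization.symmL_continuousLinearMapAt (R := ℝ) _ (by simpa using hx) v

theorem mfderiv_coordFrame (hx : x ∈ (extChartAt (𝓡 n) x₀).source) (v : Coord n) :
    mfderiv (𝓡 n) 𝓘(ℝ, Coord n) (extChartAt (𝓡 n) x₀) x (coordFrame x₀ x v) = v := by
  rw [extChartAt_source] at hx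
  rw [coordFrame, ← TangentBundle.continuousLinearMapAt_trivializationAt hx]
  exact Bundle.Trivialization.continuousLinearMapAt_symmL (R := ℝ) _ (by simpa using hx) v

theorem coordFrame_eq (hx : x ∈ (extChartAt (𝓡 n) x₀).source) (v : Coord n) :
    coordFrame x₀ x v =
      mfderiv 𝓘(ℝ, Coord n) (𝓡 n) (extChartAt (𝓡 n) x₀).symm (extChartAt (𝓡 n) x₀ x) v := by
  rw [extChartAt_source] at hx
  rw [coordFrame, TangentBundle.symmL_trivializationAt hx]
  simp [mfderivWithin_univ]
  rfl

theorem contMDiffOn_coordFrame (x₀ : M) (v : Coord n) :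
    ContMDiffOn (𝓡 n) ((𝓡 n).prod 𝓘(ℝ, Coord n)) ∞
      (fun x : M => (Bundle.TotalSpace.mk' (Coord n) x (coordFrame x₀ x v) : TangentBundle (𝓡 n) M))
      (extChartAt (𝓡 n) x₀).source := by
  intro x hx
  have h := (trivializationAt (Coord n) (TangentSpace (𝓡 n)) x₀).contMDiffAt_symmL (n := ∞)
    (IB := 𝓡 n) (x := x) (by simpa using hx)
  refine (h.clm_bundle_apply (E₁ := Bundle.Trivial M (Coord n)) (v := fun _ => v)
    ?_).contMDiffWithinAt
  rw [Bundle.contMDiffAt_section]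
  exact contMDiffAt_const

end Frame

section Linear

variable {E F : Type*} [NormedAddCommGroup E] [NormedSpace ℝ E] [FiniteDimensional ℝ E]
  [NormedAddCommGroup F] [NormedSpace ℝ F] [FiniteDimensional ℝ F]

theorem isInvertible_of_injective {A : E →L[ℝ] F} (hA : Function.Injective A)
    (h : Module.finrank ℝ E = Module.finrank ℝ F) : A.IsInvertible :=
  ⟨(LinearMap.linearEquivOfInjective A.toLinearMap hA h).toContinuousLinearEquiv, by ext; rfl⟩

theorem isInvertible_of_nondegenerate {B : E →L[ℝ] E →L[ℝ] ℝ} (h : ∀ v, (∀ w, B v w = 0) → v = 0) :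
    B.IsInvertible := by
  refine isInvertible_of_injective ((injective_iff_map_eq_zero B).2 fun v hv => h v fun w => ?_) ?_
  · simp [hv]
  · rw [← (LinearMap.toContinuousLinearMap (𝕜 := ℝ) (E := E) (F' := ℝ)).finrank_eq]
    exact (Subspace.dual_finrank_eq (K := ℝ) (V := E)).symm

end Linear

namespace PseudoMetric

variable (g : PseudoMetric n p q M) (x₀ : M)

/-- Nondegeneracy of the metric. -/
theorem eq_zero_of_forall {x : M} {v : TangentSpace (𝓡 n) x} (hv : ∀ w, g.val x v w = 0) :
    v = 0 := by
  obtain ⟨e, he⟩ := g.signature x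
  -- The vector obtained from `v` by changing the sign of the negative coordinates.
  set w : TangentSpace (𝓡 n) x := e.equivFun.symm
    (Sum.elim (fun i => e.repr v (Sum.inl i)) fun j => -e.repr v (Sum.inr j)) with hw
  have hr : ∀ k, e.repr w k
      = Sum.elim (fun i => e.repr v (Sum.inl i)) (fun j => -e.repr v (Sum.inr j)) k := fun k => by
    rw [← e.equivFun_apply, hw, LinearEquiv.apply_symm_apply]
  have h1 := he (v + w)
  have h2 := he (v - w)
  simp only [map_add, map_sub, add_apply, sub_apply, hv, g.symm x w v, Finsupp.add_apply,
    Finsupp.sub_apply, hr, Sum.elim_inl, Sum.elim_inr] at h1 h2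
  have h3 : ∑ i, (e.repr v (Sum.inl i)) ^ 2 + ∑ j, (e.repr v (Sum.inr j)) ^ 2 = 0 := by
    have e1 : ∑ i, (e.repr v (Sum.inl i) + e.repr v (Sum.inl i)) ^ 2
        = 4 * ∑ i, (e.repr v (Sum.inl i)) ^ 2 := by
      rw [Finset.mul_sum]
      exact Finset.sum_congr rfl fun _ _ => by ring
    have e2 : ∑ j, (e.repr v (Sum.inr j) - -e.repr v (Sum.inr j)) ^ 2
        = 4 * ∑ j, (e.repr v (Sum.inr j)) ^ 2 := by
      rw [Finset.mul_sum]
      exact Finset.sum_congr rfl fun _ _ => by ring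
    simp only [sub_self, add_neg_cancel, e1, e2] at h1 h2
    simp at h1 h2
    linarith
  have h4 := (add_eq_zero_iff_of_nonneg (Finset.sum_nonneg fun i _ => sq_nonneg _)
    (Finset.sum_nonneg fun i _ => sq_nonneg _)).1 h3
  rw [Finset.sum_eq_zero_iff_of_nonneg fun i _ => sq_nonneg _,
    Finset.sum_eq_zero_iff_of_nonneg fun i _ => sq_nonneg _] at h4
  apply e.repr.injective
  ext (k | k)
  · simpa using h4.1 k (Finset.mem_univ _)
  · simpa using h4.2 k (Finset.mem_univ _)

theorem inChart_apply (y v w : Coord n) : g.inChart x₀ y v w =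
    g.val ((extChartAt (𝓡 n) x₀).symm y) (coordFrame x₀ ((extChartAt (𝓡 n) x₀).symm y) v)
      (coordFrame x₀ ((extChartAt (𝓡 n) x₀).symm y) w) := rfl

theorem contMDiffOn_coordFrame (v w : Coord n) :
    ContMDiffOn (𝓡 n) 𝓘(ℝ, ℝ) ∞ (fun x => g.val x (coordFrame x₀ x v) (coordFrame x₀ x w))
      (extChartAt (𝓡 n) x₀).source := by
  intro x hx
  have h : ContMDiffWithinAt (𝓡 n) ((𝓡 n).prod 𝓘(ℝ, ℝ)) ∞
      (fun x => Bundle.TotalSpace.mk' ℝ (E := Bundle.Trivial M ℝ) x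
        (g.val x (coordFrame x₀ x v) (coordFrame x₀ x w))) (extChartAt (𝓡 n) x₀).source x := by
    apply ContMDiffWithinAt.clm_bundle_apply₂ (F₁ := Coord n) (F₂ := Coord n)
    · exact g.contMDiff.contMDiffAt.contMDiffWithinAt
    · exact ConformalCircles.contMDiffOn_coordFrame x₀ v x hx
    · exact ConformalCircles.contMDiffOn_coordFrame x₀ w x hx
  simp only [Bundle.contMDiffWithinAt_totalSpace] at h
  exact h.2

theorem isMetricOn_inChart : IsMetricOn (g.inChart x₀) (extChartAt (𝓡 n) x₀).target where
  isOpen := isOpen_extChartAt_target x₀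
  smooth := by
    refine contDiffOn_clm_apply.2 fun v => contDiffOn_clm_apply.2 fun w => ?_
    have h := (g.contMDiffOn_coordFrame x₀ v w).comp (contMDiffOn_extChartAt_symm (n := ∞) x₀)
      fun y hy => (extChartAt (𝓡 n) x₀).map_target hy
    exact contMDiffOn_iff_contDiffOn.1 h
  symm y _ v w := g.symm _ _ _
  inv y hy := by
    refine isInvertible_of_nondegenerate fun v hv => ?_
    have hx := (extChartAt (𝓡 n) x₀).map_target hy
    have h0 : coordFrame x₀ ((extChartAt (𝓡 n) x₀).symm y) v = 0 :=
      g.eq_zero_of_forall fun w => by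
        rw [← coordFrame_mfderiv hx w]
        exact hv _
    rw [← mfderiv_coordFrame hx v, h0]
    exact map_zero _

end PseudoMetric

section LocalRepresentative

variable {f : M → N} {x₀ : M} {y₀ : N}

theorem contDiffOn_localRep (hf : ContMDiff (𝓡 n) (𝓡 n) ∞ f) :
    ContDiffOn ℝ ∞ (localRep (n := n) f x₀ y₀) (localDom f x₀ y₀) := by
  rw [← contMDiffOn_iff_contDiffOn]
  have h1 := hf.comp_contMDiffOn (contMDiffOn_extChartAt_symm (n := ∞) x₀)
  have h2 : ContMDiffOn (𝓡 n) 𝓘(ℝ, Coord n) ∞ (extChartAt (𝓡 n) y₀)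
      (extChartAt (𝓡 n) y₀).source := by
    rw [extChartAt_source]
    exact contMDiffOn_extChartAt
  exact h2.comp (h1.mono inter_subset_left) fun y hy => hy.2

/-- In the coordinate frames, the differential of `f` is that of its local representative. -/
theorem mfderiv_coordFrame_localRep (hf : ContMDiff (𝓡 n) (𝓡 n) ∞ f) {y : Coord n}
    (hy : y ∈ localDom f x₀ y₀) (v : Coord n) :
    mfderiv (𝓡 n) (𝓡 n) f ((extChartAt (𝓡 n) x₀).symm y)
        (coordFrame x₀ ((extChartAt (𝓡 n) x₀).symm y) v) =
      coordFrame y₀ (f ((extChartAt (𝓡 n) x₀).symm y)) (fderiv ℝ (localRep f x₀ y₀) y v) := by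
  have hx := (extChartAt (𝓡 n) x₀).map_target hy.1
  have d1 : MDifferentiableAt 𝓘(ℝ, Coord n) (𝓡 n) (extChartAt (𝓡 n) x₀).symm y :=
    ((contMDiffOn_extChartAt_symm (n := ∞) x₀).contMDiffAt
      ((isOpen_extChartAt_target x₀).mem_nhds hy.1)).mdifferentiableAt (by simp)
  have d2 : MDifferentiableAt (𝓡 n) (𝓡 n) f ((extChartAt (𝓡 n) x₀).symm y) :=
    (hf.contMDiffAt).mdifferentiableAt (by simp)
  have d3 : MDifferentiableAt (𝓡 n) 𝓘(ℝ, Coord n) (extChartAt (𝓡 n) y₀)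
      (f ((extChartAt (𝓡 n) x₀).symm y)) := mdifferentiableAt_extChartAt (by simpa using hy.2)
  have h1 : mfderiv 𝓘(ℝ, Coord n) 𝓘(ℝ, Coord n) (localRep f x₀ y₀) y v =
      mfderiv (𝓡 n) 𝓘(ℝ, Coord n) (extChartAt (𝓡 n) y₀) (f ((extChartAt (𝓡 n) x₀).symm y))
        (mfderiv (𝓡 n) (𝓡 n) f ((extChartAt (𝓡 n) x₀).symm y)
          (mfderiv 𝓘(ℝ, Coord n) (𝓡 n) (extChartAt (𝓡 n) x₀).symm y v)) := by
    have e := mfderiv_comp y d3 (d2.comp y d1)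
    rw [mfderiv_comp y d2 d1] at e
    exact DFunLike.congr_fun e v
  rw [mfderiv_eq_fderiv] at h1
  have h2 : mfderiv 𝓘(ℝ, Coord n) (𝓡 n) (extChartAt (𝓡 n) x₀).symm y v
      = coordFrame x₀ ((extChartAt (𝓡 n) x₀).symm y) v := by
    rw [coordFrame_eq hx, (extChartAt (𝓡 n) x₀).right_inv hy.1]
  rw [h2] at h1
  exact (coordFrame_mfderiv hy.2 _).symm.trans (congrArg (coordFrame y₀ _) h1.symm)

end LocalRepresentative

end

/-! ### Conformal circles on manifolds and conformal maps -/

section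

variable {n p q : ℕ} {M : Type*} [TopologicalSpace M] [ChartedSpace (Coord n) M]
  {N : Type*} [TopologicalSpace N] [ChartedSpace (Coord n) N]

/-- The differential of `log Ω`. -/
noncomputable def dlog (Ω : M → ℝ) (x : M) : TangentSpace (𝓡 n) x →L[ℝ] ℝ :=
  mfderiv (𝓡 n) 𝓘(ℝ, ℝ) (fun x => Real.log (Ω x)) x

theorem mfderiv_injective_of_isLocalDiffeomorph {f : M → N}
    (hf : IsLocalDiffeomorph (𝓡 n) (𝓡 n) ∞ f) (x : M) :
    Function.Injective (mfderiv (𝓡 n) (𝓡 n) f x) := by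
  rw [← hf.mfderivToContinuousLinearEquiv_coe (by simp) x]
  exact (hf.mfderivToContinuousLinearEquiv (by simp) x).injective

variable [IsManifold (𝓡 n) ∞ M] [IsManifold (𝓡 n) ∞ N]

theorem fderiv_localRep_injective {f : M → N} (hf : IsLocalDiffeomorph (𝓡 n) (𝓡 n) ∞ f)
    {x₀ : M} {y₀ : N} {y : Coord n} (hy : y ∈ localDom f x₀ y₀) :
    Function.Injective (fderiv ℝ (localRep f x₀ y₀) y) := by
  refine (injective_iff_map_eq_zero _).2 fun v hv => ?_
  have h1 := mfderiv_coordFrame_localRep hf.contMDiff hy v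
  rw [hv, map_zero] at h1
  have h2 := (injective_iff_map_eq_zero _).1 (mfderiv_injective_of_isLocalDiffeomorph hf _) _ h1
  rw [← mfderiv_coordFrame ((extChartAt (𝓡 n) x₀).map_target hy.1) v, h2]
  exact map_zero _

theorem contDiffAt_chart_curve {γ : ℝ → M} {t : ℝ} (hγ : ContMDiffAt 𝓘(ℝ, ℝ) (𝓡 n) ∞ γ t) {x₀ : M}
    (hx : γ t ∈ (extChartAt (𝓡 n) x₀).source) :
    ContDiffAt ℝ ∞ (fun s => extChartAt (𝓡 n) x₀ (γ s)) t := by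
  rw [extChartAt_source] at hx
  exact contMDiffAt_iff_contDiffAt.1 ((contMDiffAt_extChartAt' (n := ∞) hx).comp t hγ)

/-- Conformal invariance of the conformal circle system: a local diffeomorphism `f` with
`f^*h = Ω² g` takes solutions for `g`, expressed in a chart of `M`, to solutions for `h`, expressed
in a chart of `N`. -/
theorem circleSystemAt_transfer (hn : 3 ≤ n) {g : PseudoMetric n p q M} {h : PseudoMetric n p q N}
    {f : M → N} (hf : IsLocalDiffeomorph (𝓡 n) (𝓡 n) ∞ f) {Ω : M → ℝ}
    (hΩ : ContMDiff (𝓡 n) 𝓘(ℝ, ℝ) ∞ Ω) (hpos : ∀ x, 0 < Ω x)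
    (hconf : ∀ (x : M) (v w : TangentSpace (𝓡 n) x), h.val (f x) (mfderiv (𝓡 n) (𝓡 n) f x v)
      (mfderiv (𝓡 n) (𝓡 n) f x w) = Ω x ^ 2 * g.val x v w)
    {γ : ℝ → M} {b : ∀ t : ℝ, TangentSpace (𝓡 n) (γ t) →L[ℝ] ℝ}
    {b' : ∀ t : ℝ, TangentSpace (𝓡 n) (f (γ t)) →L[ℝ] ℝ}
    (hb : ∀ (t : ℝ) (v : TangentSpace (𝓡 n) (γ t)), b' t (mfderiv (𝓡 n) (𝓡 n) f (γ t) v) =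
      b t v - dlog Ω (γ t) v)
    {t : ℝ} (hγ : ContMDiffAt 𝓘(ℝ, ℝ) (𝓡 n) ∞ γ t) {x₀ : M} {y₀ : N}
    (hx₀ : γ t ∈ (extChartAt (𝓡 n) x₀).source) (hy₀ : f (γ t) ∈ (extChartAt (𝓡 n) y₀).source)
    (hc : CircleSystemAt (g.inChart x₀) (fun s => extChartAt (𝓡 n) x₀ (γ s))
      (fun s => (b s).comp (coordFrame x₀ (γ s))) t) :
    CircleSystemAt (h.inChart y₀) (fun s => extChartAt (𝓡 n) y₀ (f (γ s)))
      (fun s => (b' s).comp (coordFrame y₀ (f (γ s)))) t := by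
  set ψ := extChartAt (𝓡 n) x₀ with hψ
  set F : Coord n → Coord n := localRep f x₀ y₀ with hFdef
  set U : Set (Coord n) := localDom f x₀ y₀ with hUdef
  have hfc := hf.contMDiff
  have hU : IsOpen U := isOpen_localDom hfc.continuous
  have hUT : U ⊆ ψ.target := inter_subset_left
  set G := g.inChart x₀ with hGdef
  set H := h.inChart y₀ with hHdef
  have hG : IsMetricOn G U := (g.isMetricOn_inChart x₀).mono hU hUT
  have hH : IsMetricOn H (extChartAt (𝓡 n) y₀).target := h.isMetricOn_inChart y₀
  have hlog : ContMDiff (𝓡 n) 𝓘(ℝ, ℝ) ∞ (fun x => Real.log (Ω x)) := fun x =>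
    (Real.contDiffAt_log.2 (hpos x).ne').contMDiffAt.comp x (hΩ x)
  set ρ : Coord n → ℝ := fun y => Real.log (Ω (ψ.symm y)) with hρdef
  have hρ : ContDiffOn ℝ ∞ ρ U := by
    rw [← contMDiffOn_iff_contDiffOn]
    exact (hlog.comp_contMDiffOn (contMDiffOn_extChartAt_symm (n := ∞) x₀)).mono hUT
  have hexp (y : Coord n) : Real.exp (2 * ρ y) = Ω (ψ.symm y) ^ 2 := by
    rw [two_mul, Real.exp_add, hρdef, Real.exp_log (hpos _), sq]
  -- The intermediate metric `e^{2ρ} G` is conformal to `G` and isometric to `H`.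
  set G' : FormField n := fun y => Real.exp (2 * ρ y) • G y with hG'def
  have hG' : IsMetricOn G' U := by
    refine ⟨hU, ((contDiffOn_const.mul hρ).exp).smul hG.smooth, fun y hy v w => ?_, fun y hy => ?_⟩
    · simp [hG'def, hG.symm y hy v w]
    · refine isInvertible_of_nondegenerate fun v hv => ?_
      have hv' : ∀ w, G y v w = G y 0 w := fun w => by
        have := hv w
        simpa [hG'def, (Real.exp_pos _).ne'] using this
      exact eq_of_form_eq (hG.inv y hy) hv'
  have hconfG : IsConformalOn ρ G G' U := ⟨hG, hG', hρ, fun y _ v w => by simp [hG'def]⟩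
  have hiso : IsIsometryOn F G' H U (extChartAt (𝓡 n) y₀).target := by
    refine ⟨hG', hH, contDiffOn_localRep hfc, mapsTo_localRep, fun y hy =>
      isInvertible_of_injective (fderiv_localRep_injective hf hy) rfl, fun y hy v w => ?_⟩
    have e : (extChartAt (𝓡 n) y₀).symm (F y) = f (ψ.symm y) :=
      (extChartAt (𝓡 n) y₀).left_inv hy.2
    rw [hHdef, h.inChart_apply, e, ← mfderiv_coordFrame_localRep hfc hy,
      ← mfderiv_coordFrame_localRep hfc hy, hconf]
    simp only [hG'def, smul_apply, smul_eq_mul, hexp]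
    rfl
  have hxU : ψ (γ t) ∈ U := mem_localDom hx₀ hy₀
  have hx := contDiffAt_chart_curve hγ hx₀
  have hx2 : ContDiffAt ℝ 2 (fun s => ψ (γ s)) t := hx.of_le ENat.LEInfty.out
  have h1 := (circleSystemAt_iff (x := fun s => ψ (γ s)) hG hxU).1 hc
  have h2 := hconfG.circleSystemL (by simpa using hn) hxU hx2 h1
  have h3 := hiso.circleSystemL hxU hx2 h2
  rw [circleSystemAt_iff hH ((extChartAt (𝓡 n) y₀).map_source hy₀)]
  have hsrc : ∀ᶠ s in 𝓝 t, γ s ∈ ψ.source ∧ f (γ s) ∈ (extChartAt (𝓡 n) y₀).source :=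
    (hγ.continuousAt.eventually ((isOpen_extChartAt_source x₀).mem_nhds hx₀)).and
      ((hfc.continuous.continuousAt.comp hγ.continuousAt).eventually
        ((isOpen_extChartAt_source y₀).mem_nhds hy₀))
  refine h3.congr ?_ ?_
  · filter_upwards [hsrc] with s hs
    rw [hFdef, localRep, ψ.left_inv hs.1]
  · filter_upwards [hsrc] with s hs
    have hsU : ψ (γ s) ∈ U := mem_localDom hs.1 hs.2
    have hinv := hiso.inv _ hsU
    ext z
    obtain ⟨v, rfl⟩ := hinv.surjective z
    have e := mfderiv_coordFrame_localRep hfc hsU v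
    rw [ψ.left_inv hs.1] at e
    simp only [ContinuousLinearMap.comp_apply, hinv.inverse_apply_self, sub_apply]
    have e2 := hb s (coordFrame x₀ (γ s) v)
    rw [e] at e2
    rw [hFdef, e2]
    congr 1
    have d1 : MDifferentiableAt 𝓘(ℝ, Coord n) (𝓡 n) ψ.symm (ψ (γ s)) :=
      ((contMDiffOn_extChartAt_symm (n := ∞) x₀).contMDiffAt
        ((isOpen_extChartAt_target x₀).mem_nhds (ψ.map_source hs.1))).mdifferentiableAt (by simp)
    have d2 : MDifferentiableAt (𝓡 n) 𝓘(ℝ, ℝ) (fun x => Real.log (Ω x)) (ψ.symm (ψ (γ s))) :=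
      (hlog _).mdifferentiableAt (by simp)
    have e3 := DFunLike.congr_fun (mfderiv_comp (ψ (γ s)) d2 d1) v
    rw [coordFrame_eq hs.1, ← mfderiv_eq_fderiv]
    rw [ψ.left_inv hs.1] at e3
    exact e3.symm

end

section

variable {n p q : ℕ} {M : Type*} [TopologicalSpace M] [ChartedSpace (Coord n) M]

theorem isLocalDiffeomorph_id : IsLocalDiffeomorph (𝓡 n) (𝓡 n) ∞ (id : M → M) :=
  (Diffeomorph.refl (𝓡 n) M ∞).isLocalDiffeomorph

variable [IsManifold (𝓡 n) ∞ M] {N : Type*} [TopologicalSpace N] [ChartedSpace (Coord n) N]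
  [IsManifold (𝓡 n) ∞ N]

namespace PseudoMetric

/-- A local diffeomorphism with `f^*h = Ω² g` maps conformal circles to conformal circles. -/
theorem IsCircle.map (hn : 3 ≤ n) {g : PseudoMetric n p q M} {h : PseudoMetric n p q N}
    {f : M → N} (hf : IsLocalDiffeomorph (𝓡 n) (𝓡 n) ∞ f) {Ω : M → ℝ}
    (hΩ : ContMDiff (𝓡 n) 𝓘(ℝ, ℝ) ∞ Ω) (hpos : ∀ x, 0 < Ω x)
    (hconf : ∀ (x : M) (v w : TangentSpace (𝓡 n) x), h.val (f x) (mfderiv (𝓡 n) (𝓡 n) f x v)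
      (mfderiv (𝓡 n) (𝓡 n) f x w) = Ω x ^ 2 * g.val x v w)
    {γ : ℝ → M} {b : ∀ t : ℝ, TangentSpace (𝓡 n) (γ t) →L[ℝ] ℝ} {K : Set ℝ} (hK : IsOpen K)
    (hc : g.IsCircle γ b K) :
    ∃ b' : ∀ t : ℝ, TangentSpace (𝓡 n) (f (γ t)) →L[ℝ] ℝ, h.IsCircle (f ∘ γ) b' K := by
  let b' : ∀ t : ℝ, TangentSpace (𝓡 n) (f (γ t)) →L[ℝ] ℝ := fun t =>
    (b t - dlog Ω (γ t)).comp
      ((hf.mfderivToContinuousLinearEquiv (by simp) (γ t)).symm :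
        TangentSpace (𝓡 n) (f (γ t)) →L[ℝ] TangentSpace (𝓡 n) (γ t))
  have hb' : ∀ (t : ℝ) (v : TangentSpace (𝓡 n) (γ t)), b' t (mfderiv (𝓡 n) (𝓡 n) f (γ t) v) =
      b t v - dlog Ω (γ t) v := by
    intro t v
    have e : (hf.mfderivToContinuousLinearEquiv (by simp) (γ t)).symm
        (mfderiv (𝓡 n) (𝓡 n) f (γ t) v) = v :=
      (hf.mfderivToContinuousLinearEquiv (by simp) (γ t)).symm_apply_apply v
    exact congrArg (fun u => b t u - dlog Ω (γ t) u) e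
  have hsm (t : ℝ) (ht : t ∈ K) : ContMDiffAt 𝓘(ℝ, ℝ) (𝓡 n) ∞ γ t :=
    hc.smooth.contMDiffAt (hK.mem_nhds ht)
  refine ⟨b', hf.contMDiff.comp_contMDiffOn hc.smooth, fun t ht h0 => hc.regular t ht ?_, ?_⟩
  · rw [mfderiv_comp t (hf.contMDiff.contMDiffAt.mdifferentiableAt (by simp))
      ((hsm t ht).mdifferentiableAt (by simp))] at h0
    refine ContinuousLinearMap.ext fun r => ?_
    apply mfderiv_injective_of_isLocalDiffeomorph hf (γ t)
    rw [zero_apply, map_zero]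
    exact DFunLike.congr_fun h0 r
  · intro y₀ t ht hy₀
    exact circleSystemAt_transfer hn hf hΩ hpos hconf hb' (hsm t ht) (mem_extChartAt_source (γ t))
      hy₀ (hc.system (γ t) t ht (mem_extChartAt_source (γ t)))

/-- Circles are the same for all metrics of a conformal class, up to the choice of the `1`-form. -/
theorem IsCircle.of_conformallyRelated (hn : 3 ≤ n) {g g' : PseudoMetric n p q M}
    (hgg' : ConformallyRelated g g') {γ : ℝ → M} {b : ∀ t : ℝ, TangentSpace (𝓡 n) (γ t) →L[ℝ] ℝ}
    {K : Set ℝ} (hK : IsOpen K) (hc : g.IsCircle γ b K) :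
    ∃ b' : ∀ t : ℝ, TangentSpace (𝓡 n) (γ t) →L[ℝ] ℝ, g'.IsCircle γ b' K := by
  obtain ⟨Ω, hΩ, hpos, hconf⟩ := hgg'
  refine hc.map hn (f := id) isLocalDiffeomorph_id hΩ hpos (fun x v w => ?_) hK
  rw [mfderiv_id]
  exact hconf x v w

/-- Through every point there is a conformal circle with any given non-null initial velocity and any
given initial acceleration, both read in a chart. -/
theorem exists_isCircle (hn : 3 ≤ n) (g : PseudoMetric n p q M) (x₀ : M) {u : Coord n}
    (hu : g.inChart x₀ (extChartAt (𝓡 n) x₀ x₀) u u ≠ 0) (a : Coord n) :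
    ∃ ε > 0, ∃ (x : ℝ → Coord n)
      (b : ∀ t : ℝ, TangentSpace (𝓡 n) ((extChartAt (𝓡 n) x₀).symm (x t)) →L[ℝ] ℝ),
      ContDiffOn ℝ ∞ x (Ioo (-ε) ε) ∧ x 0 = extChartAt (𝓡 n) x₀ x₀ ∧ deriv x 0 = u ∧
      deriv (deriv x) 0 = a ∧ ThirdOrder (g.inChart x₀) x 0 ∧
      g.IsCircle (fun t => (extChartAt (𝓡 n) x₀).symm (x t)) b (Ioo (-ε) ε) := by
  set ψ := extChartAt (𝓡 n) x₀ with hψ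
  have hG := g.isMetricOn_inChart x₀
  obtain ⟨ε, hε, x, β, hx, hx0, hx0', hx0'', hsys⟩ :=
    hG.exists_circleSystemL_of_accel (mem_extChartAt_target x₀) hu a
  have h0 : (0 : ℝ) ∈ Ioo (-ε) ε := ⟨by linarith, hε⟩
  have hmem (t : ℝ) (ht : t ∈ Ioo (-ε) ε) : ψ.symm (x t) ∈ ψ.source :=
    ψ.map_target (hsys t ht).1
  have hsm : ContMDiffOn 𝓘(ℝ, ℝ) (𝓡 n) ∞ (fun t => ψ.symm (x t)) (Ioo (-ε) ε) :=
    (contMDiffOn_extChartAt_symm (n := ∞) x₀).comp (contMDiffOn_iff_contDiffOn.2 hx)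
      fun t ht => (hsys t ht).1
  have hsm' (t : ℝ) (ht : t ∈ Ioo (-ε) ε) :
      ContMDiffAt 𝓘(ℝ, ℝ) (𝓡 n) ∞ (fun t => ψ.symm (x t)) t :=
    hsm.contMDiffAt (isOpen_Ioo.mem_nhds ht)
  let b : ∀ t : ℝ, TangentSpace (𝓡 n) (ψ.symm (x t)) →L[ℝ] ℝ := fun t =>
    (β t).comp (mfderiv (𝓡 n) 𝓘(ℝ, Coord n) ψ (ψ.symm (x t)) :
      TangentSpace (𝓡 n) (ψ.symm (x t)) →L[ℝ] Coord n)
  refine ⟨ε, hε, x, b, hx, hx0, hx0', hx0'', ?_, hsm, fun t ht hzero => ?_, fun x₁ t ht hx₁ => ?_⟩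
  · refine ThirdOrder.of_circle hG ((hx.contDiffAt (isOpen_Ioo.mem_nhds h0)).of_le
      ENat.LEInfty.out) (hsys 0 h0).1 (β := β) ?_ (by rw [hx0, hx0']; exact hu)
    filter_upwards [isOpen_Ioo.mem_nhds h0] with t ht using (hsys t ht).2.2
  · apply (hsys t ht).2.1
    have hev : x =ᶠ[𝓝 t] ψ ∘ fun t => ψ.symm (x t) := by
      filter_upwards [isOpen_Ioo.mem_nhds ht] with s hs
      exact (ψ.right_inv (hsys s hs).1).symm
    have d1 : MDifferentiableAt (𝓡 n) 𝓘(ℝ, Coord n) ψ (ψ.symm (x t)) :=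
      mdifferentiableAt_extChartAt (by simpa [hψ] using hmem t ht)
    have e := mfderiv_comp t d1 ((hsm' t ht).mdifferentiableAt (by simp))
    rw [hzero] at e
    rw [hev.deriv_eq, ← fderiv_apply_one_eq_deriv, ← mfderiv_eq_fderiv]
    refine (DFunLike.congr_fun e (1 : ℝ)).trans ?_
    exact map_zero (mfderiv (𝓡 n) 𝓘(ℝ, Coord n) ψ (ψ.symm (x t)))
  · refine circleSystemAt_transfer hn (f := id) (g := g) (h := g) isLocalDiffeomorph_id
      (Ω := fun _ => 1) contMDiff_const (fun _ => one_pos) (fun x v w => ?_) (b := b) (b' := b)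
      (fun t v => ?_) (hsm' t ht) (x₀ := x₀) (hmem t ht) hx₁ ?_
    · rw [mfderiv_id]
      simp
    · rw [mfderiv_id]
      have : dlog (n := n) (fun _ : M => (1 : ℝ)) (ψ.symm (x t)) = 0 := by
        rw [dlog]
        exact mfderiv_const
      rw [this]
      simp
    · rw [circleSystemAt_iff hG (ψ.map_source (hmem t ht))]
      refine (hsys t ht).2.2.congr ?_ ?_
      · filter_upwards [isOpen_Ioo.mem_nhds ht] with s hs using ψ.right_inv (hsys s hs).1
      · filter_upwards [isOpen_Ioo.mem_nhds ht] with s hs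
        ext v
        exact congrArg (β s) (mfderiv_coordFrame (hmem s hs) v)

/-- The pullback `f^*h` in the chart around `x₀`. -/
theorem inChart_localRep (h : PseudoMetric n p q N) {f : M → N}
    (hf : ContMDiff (𝓡 n) (𝓡 n) ∞ f) {x₀ : M} {y₀ : N} {y : Coord n} (hy : y ∈ localDom f x₀ y₀)
    (a b : Coord n) :
    h.inChart y₀ (localRep f x₀ y₀ y) (fderiv ℝ (localRep f x₀ y₀) y a)
        (fderiv ℝ (localRep f x₀ y₀) y b) =
      h.val (f ((extChartAt (𝓡 n) x₀).symm y))
        (mfderiv (𝓡 n) (𝓡 n) f ((extChartAt (𝓡 n) x₀).symm y)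
          (coordFrame x₀ ((extChartAt (𝓡 n) x₀).symm y) a))
        (mfderiv (𝓡 n) (𝓡 n) f ((extChartAt (𝓡 n) x₀).symm y)
          (coordFrame x₀ ((extChartAt (𝓡 n) x₀).symm y) b)) := by
  have e : (extChartAt (𝓡 n) y₀).symm (localRep f x₀ y₀ y) = f ((extChartAt (𝓡 n) x₀).symm y) :=
    (extChartAt (𝓡 n) y₀).left_inv hy.2
  rw [h.inChart_apply, e, mfderiv_coordFrame_localRep hf hy, mfderiv_coordFrame_localRep hf hy]

end PseudoMetric

/-- A local diffeomorphism that maps conformal circles to conformal circles preserves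
orthogonality to vectors `v` that are non-null for both metrics: `f` takes the circles with
initial velocity `v` and arbitrary initial acceleration to solutions of the third-order equation
of `h`. -/
theorem MapsCircles.form_div_eq (hn : 3 ≤ n) {g : PseudoMetric n p q M} {h : PseudoMetric n p q N}
    {c : ConformalClass n p q M} {d : ConformalClass n p q N} (hg : g.Represents c)
    (hh : h.Represents d) {f : M → N} (hf : IsLocalDiffeomorph (𝓡 n) (𝓡 n) ∞ f)
    (hmaps : MapsCircles c d f) (x : M) (v w : TangentSpace (𝓡 n) x) (hv : g.val x v v ≠ 0)
    (hfv : h.val (f x) (mfderiv (𝓡 n) (𝓡 n) f x v) (mfderiv (𝓡 n) (𝓡 n) f x v) ≠ 0) :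
    g.val x v w / g.val x v v =
      h.val (f x) (mfderiv (𝓡 n) (𝓡 n) f x v) (mfderiv (𝓡 n) (𝓡 n) f x w) /
        h.val (f x) (mfderiv (𝓡 n) (𝓡 n) f x v) (mfderiv (𝓡 n) (𝓡 n) f x v) := by
  set ψ := extChartAt (𝓡 n) x with hψ
  set ψ' := extChartAt (𝓡 n) (f x) with hψ'
  have hfc := hf.contMDiff
  have hxs : x ∈ ψ.source := mem_extChartAt_source x
  have hG := g.isMetricOn_inChart x
  have hH := h.isMetricOn_inChart (f x)
  have hydom : ψ x ∈ localDom f x (f x) := mem_localDom hxs (mem_extChartAt_source (f x))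
  have hGdom := hG.mono (isOpen_localDom (x₀ := x) (y₀ := f x) hfc.continuous) inter_subset_left
  have hleft : ψ.symm (ψ x) = x := ψ.left_inv hxs
  have key1 (a b : Coord n) :
      g.inChart x (ψ x) a b = g.val x (coordFrame x x a) (coordFrame x x b) := by
    rw [g.inChart_apply, hleft]
  have key2 (a b : Coord n) : h.inChart (f x) (localRep f x (f x) (ψ x))
      (fderiv ℝ (localRep f x (f x)) (ψ x) a) (fderiv ℝ (localRep f x (f x)) (ψ x) b)
      = h.val (f x) (mfderiv (𝓡 n) (𝓡 n) f x (coordFrame x x a))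
        (mfderiv (𝓡 n) (𝓡 n) f x (coordFrame x x b)) := by
    rw [h.inChart_localRep hfc hydom, hleft]
  obtain ⟨u, rfl⟩ : ∃ u, coordFrame x x u = v := ⟨_, coordFrame_mfderiv hxs v⟩
  obtain ⟨a, rfl⟩ : ∃ a, coordFrame x x a = w := ⟨_, coordFrame_mfderiv hxs w⟩
  rw [← key2, ← key2, ← key1, ← key1]
  rw [← key1] at hv
  rw [← key2] at hfv
  refine form_div_eq_of_thirdOrder hGdom hH (contDiffOn_localRep hfc) mapsTo_localRep hydom
    (fderiv_localRep_injective hf hydom) hv hfv (fun a => ?_) a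
  obtain ⟨ε, hε, z, b, hz, hz0, hz1, hz2, hthird, hcirc⟩ := g.exists_isCircle hn x hv a
  have h0 : (0 : ℝ) ∈ Ioo (-ε) ε := ⟨by linarith, hε⟩
  have hz3 : ContDiffAt ℝ 3 z 0 :=
    (hz.contDiffAt (isOpen_Ioo.mem_nhds h0)).of_le ENat.LEInfty.out
  refine ⟨z, 0, hz3, hz0, hz1, hz2, hthird, ?_⟩
  obtain ⟨-, hun⟩ := hmaps (fun t => ψ.symm (z t)) (Ioo (-ε) ε) isOpen_Ioo ordConnected_Ioo ⟨0, h0⟩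
    ⟨hcirc.smooth, fun t ht => ⟨Ioo (-ε) ε, id, isOpen_Ioo, ordConnected_Ioo, contDiffOn_id,
      by simp, mapsTo_id _, ⟨t, ht, rfl⟩, g, hg, b, hcirc⟩⟩
  obtain ⟨K, φ, hK, -, hφ, hφ', -, ⟨s, hs, hs0⟩, h', hh', b', hb'⟩ := hun 0 h0
  have hrel : ConformallyRelated h' h := Quotient.exact (hh'.trans hh.symm)
  obtain ⟨b'', hb''⟩ := hb'.of_conformallyRelated hn hrel hK
  have hφs : ContDiffAt ℝ 3 φ s := (hφ.contDiffAt (hK.mem_nhds hs)).of_le ENat.LEInfty.out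
  have hFy : ContDiffAt ℝ 3 (localRep f x (f x)) (z 0) := by
    rw [hz0]
    exact ((contDiffOn_localRep hfc).contDiffAt (hGdom.isOpen.mem_nhds hydom)).of_le
      ENat.LEInfty.out
  have hF2 := hFy.of_le two_le_three_smooth
  have hd := (deriv_deriv_comp hF2 (hz3.of_le two_le_three_smooth)).1.self_of_nhds
  have hFz : ContDiffAt ℝ 3 (fun t => localRep f x (f x) (z t)) 0 := hFy.comp 0 hz3
  have hFz0 : localRep f x (f x) (z 0) ∈ ψ'.target := by
    rw [hz0]
    exact mapsTo_localRep hydom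
  have hnn : h.inChart (f x) (localRep f x (f x) (z 0))
      (deriv (fun t => localRep f x (f x) (z t)) 0)
      (deriv (fun t => localRep f x (f x) (z t)) 0) ≠ 0 := by
    simp only [hd, hz0, hz1]
    exact hfv
  have hnn' : h.inChart (f x) (localRep f x (f x) (z (φ s)))
      (deriv (fun t => localRep f x (f x) (z t)) (φ s))
      (deriv (fun t => localRep f x (f x) (z t)) (φ s)) ≠ 0 := by
    rw [hs0]
    exact hnn
  rw [← hs0] at hFz hFz0 ⊢
  refine ThirdOrder.of_comp hH hφs (hφ' s hs) hFz hFz0 hnn' ?_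
  -- The reparametrized image curve is a conformal circle of `h` near `s`.
  have hsrc : ∀ᶠ r in 𝓝 s, r ∈ K ∧ f (ψ.symm (z (φ r))) ∈ ψ'.source := by
    refine Filter.Eventually.and (hK.mem_nhds hs) ?_
    have hcont : ContinuousAt (fun r => f (ψ.symm (z (φ r)))) s :=
      (hb'.smooth.contMDiffAt (hK.mem_nhds hs)).continuousAt
    have e : f (ψ.symm (z (φ s))) = f x := by rw [hs0, hz0, hleft]
    refine hcont.eventually ((isOpen_extChartAt_source (f x)).mem_nhds ?_)
    simp only [e]
    exact mem_extChartAt_source (f x)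
  have hcomp : deriv (fun r => localRep f x (f x) (z (φ r))) s
      = deriv φ s • deriv (fun t => localRep f x (f x) (z t)) (φ s) :=
    ((hasDerivAt_of_contDiffAt_two (hFz.of_le two_le_three_smooth)).scomp s
      (hasDerivAt_of_contDiffAt_two (hφs.of_le two_le_three_smooth))).deriv
  refine ThirdOrder.of_circle hH (hFz.comp s hφs) hFz0
    (β := fun r => (b'' r).comp (coordFrame (f x) (f (ψ.symm (z (φ r)))))) ?_ ?_
  · filter_upwards [hsrc] with r hr
    exact (circleSystemAt_iff (x := fun r => localRep f x (f x) (z (φ r))) hH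
      (ψ'.map_source hr.2)).1 (hb''.system (f x) r hr.1 hr.2)
  · rw [hcomp]
    simp only [map_smul, smul_apply, smul_eq_mul]
    exact mul_ne_zero (hφ' s hs) (mul_ne_zero (hφ' s hs) hnn')

end

/-! ### Proportional quadratic forms and conformality -/

section

section Algebra

variable {V : Type*} [AddCommGroup V] [Module ℝ V] [TopologicalSpace V] {B C : V →L[ℝ] V →L[ℝ] ℝ}

/-- Polarization. -/
theorem form_eq_smul_of_quadratic {c : ℝ} (hB : ∀ v w, B v w = B w v) (hC : ∀ v w, C v w = C w v)
    (h : ∀ v, C v v = c * B v v) (v w : V) : C v w = c * B v w := by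
  have h1 := h (v + w)
  simp only [map_add, add_apply, h v, h w, hB w v, hC w v] at h1
  linarith

/-- Two definite forms with the same orthogonality relation are proportional. -/
theorem exists_eq_smul_of_div_eq (hB : ∀ v w, B v w = B w v) (hC : ∀ v w, C v w = C w v)
    (hpos : ∀ v ≠ 0, 0 < B v v * C v v)
    (h : ∀ v ≠ 0, ∀ w, B v w / B v v = C v w / C v v) {v₀ : V} (hv₀ : v₀ ≠ 0) :
    ∃ c : ℝ, 0 < c ∧ ∀ v w, C v w = c * B v w := by
  have hb (v : V) (hv : v ≠ 0) : B v v ≠ 0 := left_ne_zero_of_mul (hpos v hv).ne'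
  have hc (v : V) (hv : v ≠ 0) : C v v ≠ 0 := right_ne_zero_of_mul (hpos v hv).ne'
  have h1 (v : V) (hv : v ≠ 0) (w : V) : C v w = C v v / B v v * B v w := by
    have := h v hv w
    have h2 := hb v hv
    have h3 := hc v hv
    field_simp at this ⊢
    linarith
  have h2 (v w : V) (hv : v ≠ 0) (hw : w ≠ 0) (hvw : B v w ≠ 0) :
      C w w / B w w = C v v / B v v := by
    have e1 := h1 v hv w
    have e2 := h1 w hw v
    rw [hC w v, hB w v, e1] at e2
    exact (mul_right_cancel₀ hvw e2).symm
  refine ⟨C v₀ v₀ / B v₀ v₀, ?_, form_eq_smul_of_quadratic hB hC fun v => ?_⟩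
  · rcases pos_and_pos_or_neg_and_neg_of_mul_pos (hpos v₀ hv₀) with ⟨p1, p2⟩ | ⟨p1, p2⟩
    · exact div_pos p2 p1
    · exact div_pos_of_neg_of_neg p2 p1
  by_cases hv : v = 0
  · simp [hv]
  suffices e : C v v / B v v = C v₀ v₀ / B v₀ v₀ by
    rw [← e, div_mul_cancel₀ _ (hb v hv)]
  by_cases h0 : B v₀ v = 0
  · -- `v₀ + v` is orthogonal to neither of the two orthogonal vectors.
    have e1 : B v₀ (v₀ + v) = B v₀ v₀ := by simp [h0]
    have e2 : B v (v₀ + v) = B v v := by simp [hB v v₀, h0]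
    have hs : v₀ + v ≠ 0 := fun hs => hb v₀ hv₀ (by rw [← e1, hs, map_zero])
    rw [← h2 v (v₀ + v) hv hs (by rw [e2]; exact hb v hv),
      h2 v₀ (v₀ + v) hv₀ hs (by rw [e1]; exact hb v₀ hv₀)]
  · exact h2 v₀ v hv₀ hv h0

/-- If a form `C` vanishes on the null vectors of `B`, then its values on a positive and a negative
vector of `B` are in the ratio of the values of `B`. -/
theorem mul_eq_mul_of_null (hB : ∀ v w, B v w = B w v) (hC : ∀ v w, C v w = C w v)
    (hnull : ∀ v, B v v = 0 → C v v = 0) {v w : V} (hv : 0 < B v v) (hw : B w w < 0) :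
    C v v * B w w = C w w * B v v := by
  set s := Real.sqrt (B v w ^ 2 - B v v * B w w) with hs
  have hpos : 0 < B v w ^ 2 - B v v * B w w := by
    nlinarith [sq_nonneg (B v w), mul_neg_of_pos_of_neg hv hw]
  have hs2 : s ^ 2 = B v w ^ 2 - B v v * B w w := Real.sq_sqrt hpos.le
  have hs0 : s ≠ 0 := (Real.sqrt_pos.2 hpos).ne'
  have expand (A : V →L[ℝ] V →L[ℝ] ℝ) (hA : ∀ v w, A v w = A w v) (a b : ℝ) :
      A (a • v + b • w) (a • v + b • w) = a ^ 2 * A v v + 2 * a * b * A v w + b ^ 2 * A w w := by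
    simp only [map_add, add_apply, map_smul, smul_apply, smul_eq_mul, hA w v]
    ring
  -- The line through `v` and `w` meets the null cone of `B` in two different points.
  have h1 := hnull (B w w • v + (-B v w + s) • w) (by
    rw [expand B hB]
    linear_combination B w w * hs2)
  have h2 := hnull (B w w • v + (-B v w - s) • w) (by
    rw [expand B hB]
    linear_combination B w w * hs2)
  rw [expand C hC] at h1 h2
  have h3 : B w w * C v w = B v w * C w w := by
    apply mul_left_cancel₀ hs0
    linear_combination (h1 - h2) / 4
  have h4 : B w w * (C v v * B w w - C w w * B v v) = 0 := by
    linear_combination (h1 + h2) / 2 + 2 * B v w * h3 - C w w * hs2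
  have := (mul_eq_zero.1 h4).resolve_left hw.ne
  linarith

/-- A form that vanishes on the null vectors of an indefinite form is a multiple of it. -/
theorem exists_eq_smul_of_null (hB : ∀ v w, B v w = B w v) (hC : ∀ v w, C v w = C w v)
    (hnull : ∀ v, B v v = 0 → C v v = 0) {v₀ w₀ : V} (hv₀ : 0 < B v₀ v₀) (hw₀ : B w₀ w₀ < 0) :
    ∃ c : ℝ, ∀ v w, C v w = c * B v w := by
  refine ⟨C v₀ v₀ / B v₀ v₀, form_eq_smul_of_quadratic hB hC fun v => ?_⟩
  have h0 := mul_eq_mul_of_null hB hC hnull hv₀ hw₀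
  have e : ∀ a b : ℝ, a * B v₀ v₀ = C v₀ v₀ * b → a = C v₀ v₀ / B v₀ v₀ * b := fun a b hab => by
    rw [div_mul_eq_mul_div, eq_div_iff hv₀.ne', hab]
  refine e _ _ ?_
  rcases lt_trichotomy (B v v) 0 with hv | hv | hv
  · exact (mul_eq_mul_of_null hB hC hnull hv₀ hv).symm
  · simp [hv, hnull v hv]
  · have h1 := mul_eq_mul_of_null hB hC hnull hv hw₀
    apply mul_right_cancel₀ hw₀.ne
    linear_combination B v₀ v₀ * h1 - B v v * h0

end Algebra

section Inertia

variable {V : Type*} [AddCommGroup V] [Module ℝ V] {ι κ ι' κ' : Type*} [Fintype ι] [Fintype κ]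
  [Fintype ι'] [Fintype κ']

/-- A negative multiple of a diagonal form with positive part indexed by `ι` has a negative part at
least as large. -/
theorem card_le_card_of_neg (e : Module.Basis (ι ⊕ κ) ℝ V) (e' : Module.Basis (ι' ⊕ κ') ℝ V) {c : ℝ}
    (hc : c < 0)
    (h : ∀ v, ∑ i, (e'.repr v (Sum.inl i)) ^ 2 - ∑ j, (e'.repr v (Sum.inr j)) ^ 2 =
      c * (∑ i, (e.repr v (Sum.inl i)) ^ 2 - ∑ j, (e.repr v (Sum.inr j)) ^ 2)) :
    Fintype.card ι ≤ Fintype.card κ' := by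
  classical
  -- The span of the positive vectors of `e` injects into the negative coordinates of `e'`.
  let m : (ι → ℝ) →ₗ[ℝ] V := Fintype.linearCombination ℝ fun i => e (Sum.inl i)
  let T : (ι → ℝ) →ₗ[ℝ] (κ' → ℝ) := LinearMap.pi fun j => (e'.coord (Sum.inr j)).comp m
  have hm1 (a : ι → ℝ) (i : ι) : e.repr (m a) (Sum.inl i) = a i := by
    simp [m, Fintype.linearCombination_apply, Finsupp.single_apply]
  have hm2 (a : ι → ℝ) (j : κ) : e.repr (m a) (Sum.inr j) = 0 := by
    simp [m, Fintype.linearCombination_apply]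
  have hT : Function.Injective T := by
    refine (injective_iff_map_eq_zero T).2 fun a ha => ?_
    have h1 := h (m a)
    have h2 (j : κ') : e'.repr (m a) (Sum.inr j) = 0 := congrFun ha j
    simp only [hm1, hm2, h2] at h1
    simp only [ne_eq, OfNat.ofNat_ne_zero, not_false_eq_true, zero_pow, Finset.sum_const_zero,
      sub_zero] at h1
    have h3 : 0 ≤ ∑ i, (e'.repr (m a) (Sum.inl i)) ^ 2 := Finset.sum_nonneg fun i _ => sq_nonneg _
    have h4 : 0 ≤ ∑ i, a i ^ 2 := Finset.sum_nonneg fun i _ => sq_nonneg _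
    have h5 : ∑ i, a i ^ 2 = 0 := by nlinarith
    rw [Finset.sum_eq_zero_iff_of_nonneg fun i _ => sq_nonneg _] at h5
    exact funext fun i => by simpa using h5 i (Finset.mem_univ i)
  simpa using LinearMap.finrank_le_finrank_of_injective hT

end Inertia

variable {n p q : ℕ} {M : Type*} [TopologicalSpace M] [ChartedSpace (Coord n) M]
  [IsManifold (𝓡 n) ∞ M] {N : Type*} [TopologicalSpace N] [ChartedSpace (Coord n) N]
  [IsManifold (𝓡 n) ∞ N]

theorem PseudoMetric.add_eq (g : PseudoMetric n p q M) (x : M) : p + q = n := by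
  obtain ⟨e, -⟩ := g.signature x
  have h := Module.finrank_eq_card_basis e
  have h' : Module.finrank ℝ (TangentSpace (𝓡 n) x) = n := finrank_euclideanSpace_fin (𝕜 := ℝ)
  rw [h'] at h
  simpa using h.symm

theorem PseudoMetric.exists_val_eq_one (g : PseudoMetric n p q M) (x : M) (hp : 0 < p) :
    ∃ v, g.val x v v = 1 := by
  obtain ⟨e, he⟩ := g.signature x
  refine ⟨e (Sum.inl ⟨0, hp⟩), ?_⟩
  simp [he, Finsupp.single_apply]

theorem PseudoMetric.exists_val_eq_neg_one (g : PseudoMetric n p q M) (x : M) (hq : 0 < q) :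
    ∃ v, g.val x v v = -1 := by
  obtain ⟨e, he⟩ := g.signature x
  refine ⟨e (Sum.inr ⟨0, hq⟩), ?_⟩
  simp [he, Finsupp.single_apply]

theorem PseudoMetric.val_pos (g : PseudoMetric n p 0 M) {x : M} {v : TangentSpace (𝓡 n) x}
    (hv : v ≠ 0) : 0 < g.val x v v := by
  obtain ⟨e, he⟩ := g.signature x
  rw [he]
  simp only [Finset.univ_eq_empty, Finset.sum_empty, sub_zero]
  refine lt_of_le_of_ne (Finset.sum_nonneg fun i _ => sq_nonneg _) fun h0 => hv ?_
  rw [eq_comm, Finset.sum_eq_zero_iff_of_nonneg fun i _ => sq_nonneg _] at h0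
  apply e.repr.injective
  ext (k | k)
  · simpa using h0 k (Finset.mem_univ _)
  · exact k.elim0

theorem PseudoMetric.val_neg (g : PseudoMetric n 0 q M) {x : M} {v : TangentSpace (𝓡 n) x}
    (hv : v ≠ 0) : g.val x v v < 0 := by
  obtain ⟨e, he⟩ := g.signature x
  rw [he]
  simp only [Finset.univ_eq_empty, Finset.sum_empty, zero_sub, neg_lt_zero]
  refine lt_of_le_of_ne (Finset.sum_nonneg fun i _ => sq_nonneg _) fun h0 => hv ?_
  rw [eq_comm, Finset.sum_eq_zero_iff_of_nonneg fun i _ => sq_nonneg _] at h0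
  apply e.repr.injective
  ext (k | k)
  · exact k.elim0
  · simpa using h0 k (Finset.mem_univ _)

/-- The form `f^*h` on the tangent space at `x`. -/
noncomputable def PseudoMetric.pullback (h : PseudoMetric n p q N) (f : M → N) (x : M) :
    TangentSpace (𝓡 n) x →L[ℝ] TangentSpace (𝓡 n) x →L[ℝ] ℝ :=
  (ContinuousLinearMap.precomp ℝ (mfderiv (𝓡 n) (𝓡 n) f x)).comp
    ((h.val (f x)).comp (mfderiv (𝓡 n) (𝓡 n) f x))

/-- If `f^*h` is a nonzero multiple of `g` at a point and `p ≠ q`, then the factor is positive: a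
negative one would exchange the numbers of positive and negative directions. -/
theorem pos_of_pullback_eq_smul {g : PseudoMetric n p q M} {h : PseudoMetric n p q N} {f : M → N}
    (hf : IsLocalDiffeomorph (𝓡 n) (𝓡 n) ∞ f) (hpq : p ≠ q) {x : M} {c : ℝ} (hc : c ≠ 0)
    (h1 : ∀ v w, h.pullback f x v w = c * g.val x v w) : 0 < c := by
  by_contra hneg
  have hc' : c < 0 := lt_of_le_of_ne (not_lt.1 hneg) hc
  obtain ⟨e, he⟩ := g.signature x
  obtain ⟨e', he'⟩ := h.signature (f x)
  let D := hf.mfderivToContinuousLinearEquiv (by simp) x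
  let e'' := e'.map D.symm.toLinearEquiv
  have hrepr (v : TangentSpace (𝓡 n) x) (k : Fin p ⊕ Fin q) :
      e''.repr v k = e'.repr (mfderiv (𝓡 n) (𝓡 n) f x v) k := by
    rw [← hf.mfderivToContinuousLinearEquiv_coe (by simp) x]
    rfl
  have h2 (v : TangentSpace (𝓡 n) x) :
      ∑ i, (e''.repr v (Sum.inl i)) ^ 2 - ∑ j, (e''.repr v (Sum.inr j)) ^ 2 =
      c * (∑ i, (e.repr v (Sum.inl i)) ^ 2 - ∑ j, (e.repr v (Sum.inr j)) ^ 2) := by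
    simp only [hrepr]
    rw [← he, ← he', ← h1]
    rfl
  have l1 := card_le_card_of_neg e e'' hc' h2
  have l2 := card_le_card_of_neg (e.reindex (Equiv.sumComm _ _)) (e''.reindex (Equiv.sumComm _ _))
    hc' fun v => by
      simp only [Module.Basis.repr_reindex_apply, Equiv.sumComm_symm, Equiv.sumComm_apply,
        Sum.swap_inl, Sum.swap_inr]
      linarith [h2 v]
  simp only [Fintype.card_fin] at l1 l2
  exact hpq (le_antisymm l1 l2)

theorem ConformalClass.sgn_eq {c : ConformalClass n p q M} {g : PseudoMetric n p q M}
    (hg : g.Represents c) (x : M) (v : TangentSpace (𝓡 n) x) :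
    c.sgn x v = SignType.sign (g.val x v v) := by
  subst hg
  rfl

/-- Pointwise conformality. In definite signature it comes from the conformal circles, in indefinite
signature from the null cone alone. -/
theorem exists_pullback_eq_smul (hn : 3 ≤ n) {g : PseudoMetric n p q M} {h : PseudoMetric n p q N}
    {c : ConformalClass n p q M} {d : ConformalClass n p q N} (hg : g.Represents c)
    (hh : h.Represents d) {f : M → N} (hf : IsLocalDiffeomorph (𝓡 n) (𝓡 n) ∞ f)
    (hne : p ≠ q → ∀ (x : M) (v : TangentSpace (𝓡 n) x),
      d.sgn (f x) (mfderiv (𝓡 n) (𝓡 n) f x v) = 0 ↔ c.sgn x v = 0)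
    (heq : p = q → ∀ (x : M) (v : TangentSpace (𝓡 n) x),
      c.sgn x v = d.sgn (f x) (mfderiv (𝓡 n) (𝓡 n) f x v))
    (hmaps : MapsCircles c d f) (x : M) :
    ∃ k : ℝ, 0 < k ∧ ∀ v w, h.pullback f x v w = k * g.val x v w := by
  have hsum := g.add_eq x
  have hsymm (v w : TangentSpace (𝓡 n) x) : h.pullback f x v w = h.pullback f x w v :=
    h.symm _ _ _
  have hdf {v : TangentSpace (𝓡 n) x} (hv : v ≠ 0) : mfderiv (𝓡 n) (𝓡 n) f x v ≠ 0 := fun h0 =>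
    hv ((injective_iff_map_eq_zero _).1 (mfderiv_injective_of_isLocalDiffeomorph hf x) v h0)
  have hdef {v₀ : TangentSpace (𝓡 n) x} (hv₀ : v₀ ≠ 0)
      (hpos : ∀ v ≠ 0, 0 < g.val x v v * h.pullback f x v v) :
      ∃ k : ℝ, 0 < k ∧ ∀ v w, h.pullback f x v w = k * g.val x v w :=
    exists_eq_smul_of_div_eq (g.symm x) hsymm hpos (fun v hv w =>
      hmaps.form_div_eq hn hg hh hf x v w (left_ne_zero_of_mul (hpos v hv).ne')
        (right_ne_zero_of_mul (hpos v hv).ne')) hv₀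
  rcases Nat.eq_zero_or_pos q with rfl | hq
  · obtain ⟨v₀, hv₀⟩ := g.exists_val_eq_one x (by omega)
    exact hdef (v₀ := v₀) (by rintro rfl; simp at hv₀) fun v hv =>
      mul_pos (g.val_pos hv) (h.val_pos (hdf hv))
  rcases Nat.eq_zero_or_pos p with rfl | hp
  · obtain ⟨v₀, hv₀⟩ := g.exists_val_eq_neg_one x (by omega)
    exact hdef (v₀ := v₀) (by rintro rfl; simp at hv₀) fun v hv =>
      mul_pos_of_neg_of_neg (g.val_neg hv) (h.val_neg (hdf hv))
  obtain ⟨v₀, hv₀⟩ := g.exists_val_eq_one x hp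
  obtain ⟨w₀, hw₀⟩ := g.exists_val_eq_neg_one x hq
  have hnull (v : TangentSpace (𝓡 n) x) : h.pullback f x v v = 0 ↔ g.val x v v = 0 := by
    by_cases hpq : p = q
    · have h1 := heq hpq x v
      rw [ConformalClass.sgn_eq hg, ConformalClass.sgn_eq hh] at h1
      rw [← sign_eq_zero_iff, ← sign_eq_zero_iff (a := g.val x v v), h1]
      rfl
    · have h1 := hne hpq x v
      rwa [ConformalClass.sgn_eq hg, ConformalClass.sgn_eq hh, sign_eq_zero_iff,
        sign_eq_zero_iff] at h1
  obtain ⟨k, hk⟩ := exists_eq_smul_of_null (g.symm x) hsymm (fun v => (hnull v).2)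
    (v₀ := v₀) (w₀ := w₀) (by rw [hv₀]; exact one_pos) (by rw [hw₀]; norm_num)
  refine ⟨k, ?_, hk⟩
  have hkv := hk v₀ v₀
  rw [hv₀, mul_one] at hkv
  by_cases hpq : p = q
  · have h1 := heq hpq x v₀
    rw [ConformalClass.sgn_eq hg, ConformalClass.sgn_eq hh, hv₀, sign_one, eq_comm,
      sign_eq_one_iff] at h1
    rw [← hkv]
    exact h1
  · refine pos_of_pullback_eq_smul hf hpq (fun h0 => ?_) hk
    have := (hnull v₀).1 (by rw [hkv, h0])
    rw [hv₀] at this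
    exact one_ne_zero this

/-- A pointwise conformal factor is smooth: near each point it is the quotient of the values of the
two metrics on a coordinate vector. -/
theorem contMDiff_of_pullback_eq_smul {g : PseudoMetric n p q M} {h : PseudoMetric n p q N}
    (hn : 0 < n) {f : M → N} (hf : ContMDiff (𝓡 n) (𝓡 n) ∞ f) {k : M → ℝ}
    (hk : ∀ x v w, h.pullback f x v w = k x * g.val x v w) :
    ContMDiff (𝓡 n) 𝓘(ℝ, ℝ) ∞ k := by
  intro x
  set ψ := extChartAt (𝓡 n) x with hψ
  have hxs : x ∈ ψ.source := mem_extChartAt_source x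
  have hG := g.isMetricOn_inChart x
  have hH := h.isMetricOn_inChart (f x)
  have hydom : ψ x ∈ localDom f x (f x) := mem_localDom hxs (mem_extChartAt_source (f x))
  have hopen := isOpen_localDom (n := n) (x₀ := x) (y₀ := f x) hf.continuous
  obtain ⟨v, hv⟩ : ∃ v, g.val x v v ≠ 0 := by
    have hsum := g.add_eq x
    rcases Nat.eq_zero_or_pos p with rfl | hp
    · obtain ⟨v, hv⟩ := g.exists_val_eq_neg_one x (by omega)
      exact ⟨v, by rw [hv]; norm_num⟩
    · obtain ⟨v, hv⟩ := g.exists_val_eq_one x hp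
      exact ⟨v, by rw [hv]; norm_num⟩
  obtain ⟨u, rfl⟩ : ∃ u, coordFrame x x u = v := ⟨_, coordFrame_mfderiv hxs v⟩
  have hu : g.inChart x (ψ x) u u ≠ 0 := by
    rw [g.inChart_apply, ψ.left_inv hxs]
    exact hv
  have hG' := hG.smooth.contDiffAt (hG.isOpen.mem_nhds (ψ.map_source hxs))
  have hF := (contDiffOn_localRep (x₀ := x) (y₀ := f x) hf).contDiffAt (hopen.mem_nhds hydom)
  have hH' : ContDiffAt ℝ ∞ (fun y => h.inChart (f x) (localRep f x (f x) y)) (ψ x) :=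
    ContDiffAt.comp (ψ x) (hH.smooth.contDiffAt (hH.isOpen.mem_nhds (mapsTo_localRep hydom))) hF
  have hDF : ContDiffAt ℝ ∞ (fun y => fderiv ℝ (localRep f x (f x)) y u) (ψ x) :=
    (hF.fderiv_right (m := ∞) (by simp)).clm_apply contDiffAt_const
  have hq : ContDiffAt ℝ ∞ (fun y => h.inChart (f x) (localRep f x (f x) y)
      (fderiv ℝ (localRep f x (f x)) y u) (fderiv ℝ (localRep f x (f x)) y u) /
        g.inChart x y u u) (ψ x) :=
    ((hH'.clm_apply hDF).clm_apply hDF).div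
      ((hG'.clm_apply contDiffAt_const).clm_apply contDiffAt_const) hu
  have hψs : ContMDiffAt (𝓡 n) 𝓘(ℝ, Coord n) ∞ ψ x := contMDiffAt_extChartAt
  refine (hq.contMDiffAt.comp x hψs).congr_of_eventuallyEq ?_
  have hnear : ∀ᶠ y in 𝓝 (ψ x), y ∈ localDom f x (f x) ∧ g.inChart x y u u ≠ 0 :=
    Filter.Eventually.and (hopen.mem_nhds hydom)
      (((hG'.clm_apply contDiffAt_const).clm_apply contDiffAt_const).continuousAt.eventually_ne hu)
  filter_upwards [hψs.continuousAt.eventually hnear, (isOpen_extChartAt_source x).mem_nhds hxs]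
    with z hz hzs
  have e := h.inChart_localRep hf hz.1 u u
  have hz2 := hz.2
  rw [g.inChart_apply, ψ.left_inv hzs] at hz2
  rw [ψ.left_inv hzs] at e
  simp only [Function.comp_apply]
  rw [e, g.inChart_apply, ψ.left_inv hzs, eq_div_iff hz2]
  exact (hk z _ _).symm

theorem IsConformalTransformation.mapsCircles (hn : 3 ≤ n) {c : ConformalClass n p q M}
    {d : ConformalClass n p q N} {f : M → N} (hf : IsLocalDiffeomorph (𝓡 n) (𝓡 n) ∞ f)
    (hconf : IsConformalTransformation c d f) : MapsCircles c d f := by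
  rintro γ J - - - ⟨hγ, hcirc⟩
  refine ⟨hf.contMDiff.comp_contMDiffOn hγ, fun t ht => ?_⟩
  obtain ⟨K, φ, hK, hK', hφ, hφ', hKJ, htK, g, hg, b, hb⟩ := hcirc t ht
  obtain ⟨h, hh⟩ := Quotient.exists_rep d
  obtain ⟨Ω, hΩ, hpos, hfh⟩ := hconf g h hg hh
  obtain ⟨b', hb'⟩ := hb.map hn hf hΩ hpos hfh hK
  exact ⟨K, φ, hK, hK', hφ, hφ', hKJ, htK, h, hh, b', hb'⟩

theorem MapsCircles.isConformalTransformation (hn : 3 ≤ n) {c : ConformalClass n p q M}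
    {d : ConformalClass n p q N} {f : M → N} (hf : IsLocalDiffeomorph (𝓡 n) (𝓡 n) ∞ f)
    (hne : p ≠ q → ∀ (x : M) (v : TangentSpace (𝓡 n) x),
      d.sgn (f x) (mfderiv (𝓡 n) (𝓡 n) f x v) = 0 ↔ c.sgn x v = 0)
    (heq : p = q → ∀ (x : M) (v : TangentSpace (𝓡 n) x),
      c.sgn x v = d.sgn (f x) (mfderiv (𝓡 n) (𝓡 n) f x v))
    (hmaps : MapsCircles c d f) : IsConformalTransformation c d f := by
  intro g h hg hh
  choose k hk hkf using exists_pullback_eq_smul hn hg hh hf hne heq hmaps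
  have hks : ContMDiff (𝓡 n) 𝓘(ℝ, ℝ) ∞ k :=
    contMDiff_of_pullback_eq_smul (by omega) hf.contMDiff hkf
  refine ⟨fun x => Real.sqrt (k x), fun x => ?_, fun x => Real.sqrt_pos.2 (hk x), fun x v w => ?_⟩
  · exact (Real.contDiffAt_sqrt (hk x).ne').contMDiffAt.comp x (hks x)
  · rw [Real.sq_sqrt (hk x).le]
    exact hkf x v w

end

end ConformalCircles

theorem theorem2p1 {n p q : ℕ} (hn : 3 ≤ n)
    {M : Type*} [TopologicalSpace M] [ChartedSpace (ConformalCircles.Coord n) M]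
    [IsManifold (𝓡 n) ∞ M]
    {N : Type*} [TopologicalSpace N] [ChartedSpace (ConformalCircles.Coord n) N]
    [IsManifold (𝓡 n) ∞ N]
    (c : ConformalCircles.ConformalClass n p q M) (d : ConformalCircles.ConformalClass n p q N)
    (f : M → N) (hf : IsLocalDiffeomorph (𝓡 n) (𝓡 n) ∞ f)
    (hne : p ≠ q → ∀ (x : M) (v : TangentSpace (𝓡 n) x),
      d.sgn (f x) (mfderiv (𝓡 n) (𝓡 n) f x v) = 0 ↔ c.sgn x v = 0)
    (heq : p = q → ∀ (x : M) (v : TangentSpace (𝓡 n) x),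
      c.sgn x v = d.sgn (f x) (mfderiv (𝓡 n) (𝓡 n) f x v)) :
    ConformalCircles.MapsCircles c d f ↔ ConformalCircles.IsConformalTransformation c d f := by
  exact ⟨fun hmaps => hmaps.isConformalTransformation hn hf hne heq,
    fun hconf => hconf.mapsCircles hn hf⟩
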